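/- Let $k=\mathbb{R}$ or $k=\mathbb{C}$, let $G$ be a finite-dimensional second countable Lie group over $k$ with Lie algebra $\mathfrak{g}$, and let $G_1,G_2$ be locally compact groups. Let $i:G_1\to G$ be a homomorphism and $j:G_2\to G$ an anti-homomorphism, both with closed images and homeomorphisms onto these images, such that $i(G_1)\cap j(G_2)=\{e\}$ and the complement of $i(G_1)j(G_2)$ in $G$ has Haar measure zero (that is, $(G_1,G_2\subset G)$ is a matched pair of Lie groups). If $k=\mathbb{C}$, assume moreover that the closed subgroups $i(G_1)$ and $j(G_2)$ are complex Lie subgroups (embedded complex submanifolds) of $G$; if $k=\mathbb{R}$, nothing more is assumed. Then the sets $$\mathfrak{g}_1=\{X\in\mathfrak{g} : \exp(tX)\in i(G_1)\ \text{for all } t\in\mathbb{R}\},\qquad \mathfrak{g}_2=\{X\in\mathfrak{g} : \exp(tX)\in j(G_2)\ \text{for all } t\in\mathbb{R}\}$$ are Lie subalgebras of $\mathfrak{g}$ over $k$ (the Lie algebras of the closed subgroups $i(G_1)$ and $j(G_2)$), and they form a matched pair of Lie algebras, that is, $\mathfrak{g}=\mathfrak{g}_1\oplus\mathfrak{g}_2$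 as vector spaces. -/

import Mathlib

open scoped Manifold ContDiff Topology

noncomputable section

/-- A matched pair of locally compact groups: `i : G₁ → G` is a homomorphism and `j : G₂ → G` an
anti-homomorphism (that is, a homomorphism on the opposite group of `G₂`), both are homeomorphisms
onto closed images, these images meet only in the unit, and the complement of `i(G₁) j(G₂)` is null
for the Haar measure `μ` of `G`. -/
structure IsMatchedPairOfGroups {G G₁ G₂ : Type*}
    [Group G] [TopologicalSpace G] [MeasurableSpace G]
    [Group G₁] [TopologicalSpace G₁] [Group G₂] [TopologicalSpace G₂]
    (μ : MeasureTheory.Measure G) [μ.IsHaarMeasure] (i : G₁ →* G) (j : G₂ᵐᵒᵖ →* G) : Prop where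
  isClosedEmbedding_left : Topology.IsClosedEmbedding i
  isClosedEmbedding_right : Topology.IsClosedEmbedding fun s : G₂ => j (MulOpposite.op s)
  inter_eq : Set.range i ∩ Set.range j = {1}
  measure_compl_eq_zero : μ {x : G | ∃ (g : G₁) (s : G₂), i g * j (MulOpposite.op s) = x}ᶜ = 0

/-- Two Lie subalgebras of a Lie algebra `L` form a matched pair if `L` is their direct sum as a
vector space. -/
def IsMatchedPairOfLieAlgebras {𝕜 L : Type*} [Field 𝕜] [LieRing L] [LieAlgebra 𝕜 L]
    (𝔤₁ 𝔤₂ : LieSubalgebra 𝕜 L) : Prop :=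
  IsCompl 𝔤₁.toSubmodule 𝔤₂.toSubmodule

section LieGroup

variable {𝕜 : Type*} [RCLike 𝕜] {E : Type*} [NormedAddCommGroup E] [NormedSpace 𝕜 E]
  {G : Type*} [Group G] [TopologicalSpace G] [ChartedSpace E G]

/-- A smooth Lie group over `ℝ` or `ℂ` has enough regularity for Mathlib's Lie bracket on its
tangent space at the unit. -/
instance instLieGroupMinSmoothness [LieGroup 𝓘(𝕜, E) ∞ G] :
    LieGroup 𝓘(𝕜, E) (minSmoothness 𝕜 3) G := by
  rw [minSmoothness_of_isRCLikeNormedField]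
  infer_instance

/-- `γ : ℝ → G` is the one-parameter subgroup `t ↦ exp (t X)` of the Lie group `G`: the continuous
homomorphism from the additive group `ℝ` whose velocity at `0`, read in the preferred chart at the
unit (which is the one identifying the tangent space at the unit with the model space), is `X`. -/
structure IsOneParameterSubgroup (X : GroupLieAlgebra 𝓘(𝕜, E) G) (γ : ℝ → G) : Prop where
  continuous : Continuous γ
  map_add : ∀ s t : ℝ, γ (s + t) = γ s * γ t
  tendsto_velocity : Filter.Tendsto
    (fun t : ℝ => ((t⁻¹ : ℝ) : 𝕜) • (chartAt E (1 : G) (γ t) - chartAt E (1 : G) (1 : G)))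
    (𝓝[≠] (0 : ℝ)) (𝓝 (X : E))

/-- The tangent vectors `X` at the unit with `exp (t X) ∈ S` for all real `t`. For a closed
subgroup `S` this is the Lie algebra of `S`. -/
def lieAlgebraCarrier (𝕜 : Type*) [RCLike 𝕜] {E : Type*} [NormedAddCommGroup E] [NormedSpace 𝕜 E]
    {G : Type*} [Group G] [TopologicalSpace G] [ChartedSpace E G] (S : Subgroup G) :
    Set (GroupLieAlgebra 𝓘(𝕜, E) G) :=
  {X | ∃ γ : ℝ → G, IsOneParameterSubgroup X γ ∧ ∀ t, γ t ∈ S}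

/-- The Lie subalgebra `𝔥` of the Lie algebra of `G` is the Lie algebra of the subgroup `S`. -/
def IsLieAlgebraOf [CompleteSpace E] [LieGroup 𝓘(𝕜, E) ∞ G]
    (𝔥 : LieSubalgebra 𝕜 (GroupLieAlgebra 𝓘(𝕜, E) G)) (S : Subgroup G) : Prop :=
  (𝔥 : Set (GroupLieAlgebra 𝓘(𝕜, E) G)) = lieAlgebraCarrier 𝕜 S

/-- `S` is a Lie subgroup over `𝕜` of `G`: around each of its points it is the preimage of a
`𝕜`-linear subspace of the model space under some chart of `G` (smooth for `𝕜 = ℝ`, holomorphic for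
`𝕜 = ℂ`), so that it is an embedded submanifold over `𝕜`. -/
def IsEmbeddedLieSubgroup (𝕜 : Type*) [RCLike 𝕜] (E : Type*) [NormedAddCommGroup E]
    [NormedSpace 𝕜 E] {G : Type*} [Group G] [TopologicalSpace G] [ChartedSpace E G]
    (S : Subgroup G) : Prop :=
  ∀ h ∈ S, ∃ φ ∈ IsManifold.maximalAtlas 𝓘(𝕜, E) ∞ G, h ∈ φ.source ∧
    ∃ V : Submodule 𝕜 E, ∀ x ∈ φ.source, x ∈ S ↔ φ x ∈ V

end LieGroup

end

/-!
Everything is read in a chart `κ` at the unit with `κ 1 = 0`, where the group law is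
`κ (x y) = κ x + κ y + r (x, y)` with a remainder vanishing on both axes. This gives the bound
`‖r (x, a) - r (y, b)‖ ≤ C (‖a‖ ‖x - y‖ + ‖y‖ ‖a - b‖)` (`exists_bound_of_contDiffAt_product`), from
which all first-order estimates follow. Neither the exponential map nor ordinary differential equations
are used.

The central fact is `IsGroupChart.exists_oneParameter_of_tendsto`: if `h → 1` in a closed subgroup
`S` and `κ(h) / t → X` with `t → 0⁺`, then `X` is the velocity of a one-parameter subgroup of `S`,
obtained as a limit of the powers `h ^ ⌊s / t⌋`. Applied to the products `γ(t) η(t)` of two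
one-parameter subgroups and to their commutators, with parameter `t²`, it shows that the velocities
form a real vector space stable under the bracket, since the bracket is the antisymmetrized quadratic
part of the group law (`bracket_eq_quadraticPart`). Over `ℂ`, a chart that straightens `S` to a complex
subspace provides stability under complex scalars.

The same fact shows, by compactness, that near the unit `S` is a Lipschitz graph over its tangent
space (`exists_antilipschitz_on_chartBall`), so its Hausdorff dimension there is at most the dimension
of the Lie algebra. If the dimensions of `𝔤₁` and `𝔤₂` add up to less than `dim 𝔤`, the product of
the subgroups is therefore a countable union of sets that are Lebesgue null in the chart together
with all their right translates. Such sets are null for the Haar measure by Tonelli's theorem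
(`haar_eq_zero_of_forall_chart_image`), and the group itself would be null. Finally, `𝔤₁ ∩ 𝔤₂ = 0`
because a one-parameter subgroup is determined near `0` by its velocity
(`IsChartOneParameter.eventually_eq`).
-/

section

open Filter Set Metric MeasureTheory


/-! ### Local products on a vector space -/

theorem Filter.Eventually.exists_nhds_prod_self {X : Type*} [TopologicalSpace X] {a : X}
    {p : X × X → Prop} (h : ∀ᶠ q in 𝓝 (a, a), p q) :
    ∃ t ∈ 𝓝 a, ∀ x ∈ t, ∀ y ∈ t, p (x, y) := by
  rw [nhds_prod_eq] at h
  exact eventually_prod_self_iff'.1 h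

section LocalProduct

variable {𝕜 : Type*} [RCLike 𝕜] {E : Type*} [NormedAddCommGroup E] [NormedSpace ℝ E]
  [NormedSpace 𝕜 E]

/-- The partial derivative of `f` in its second variable. -/
noncomputable def partialSnd (𝕜 : Type*) [RCLike 𝕜] {E : Type*} [NormedAddCommGroup E]
    [NormedSpace 𝕜 E] (f : E × E → E) (p : E × E) : E →L[𝕜] E :=
  (fderiv 𝕜 f p).comp (ContinuousLinearMap.inr 𝕜 E E)

omit [NormedSpace ℝ E] in
theorem contDiffAt_partialSnd {f : E × E → E} (hf : ContDiffAt 𝕜 2 f 0) :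
    ContDiffAt 𝕜 1 (partialSnd 𝕜 f) 0 :=
  (hf.fderiv_right (m := 1) (by norm_num)).clm_comp contDiffAt_const

omit [NormedSpace ℝ E] in
theorem eventually_hasFDerivAt_partialSnd {f : E × E → E} (hf : ContDiffAt 𝕜 2 f 0) :
    ∀ᶠ p in 𝓝 (0 : E × E), HasFDerivAt (fun y => f (p.1, y)) (partialSnd 𝕜 f p) p.2 := by
  filter_upwards [hf.eventually (by simp)] with p hp
  have h1 : HasFDerivAt f (fderiv 𝕜 f p) (p.1, p.2) :=
    (hp.differentiableAt (by norm_num)).hasFDerivAt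
  exact h1.comp p.2 (hasFDerivAt_prodMk_right p.1 p.2)

omit [NormedSpace ℝ E] in
theorem eventually_partialSnd_eq_id {f : E × E → E} (hf : ContDiffAt 𝕜 2 f 0)
    (hl : ∀ᶠ y in 𝓝 (0 : E), f (0, y) = y) :
    ∀ᶠ y in 𝓝 (0 : E), partialSnd 𝕜 f (0, y) = ContinuousLinearMap.id 𝕜 E := by
  have hc : Tendsto (fun y : E => ((0 : E), y)) (𝓝 0) (𝓝 0) := by
    have : Continuous fun y : E => ((0 : E), y) := by fun_prop
    simpa using! this.tendsto 0
  filter_upwards [hc.eventually (eventually_hasFDerivAt_partialSnd hf), hl.eventually_nhds]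
    with y h1 h2
  have h3 : HasFDerivAt (fun y => f (0, y)) (ContinuousLinearMap.id 𝕜 E) y :=
    (hasFDerivAt_id y).congr_of_eventuallyEq h2
  exact h1.unique h3

/-- A `C²` local product with unit `0` is addition up to a remainder that vanishes on both axes. The
bound comes from the mean value inequality in the second variable, as the partial derivative is
Lipschitz and is the identity on the second axis. -/
theorem exists_bound_of_contDiffAt_product {f : E × E → E} (hf : ContDiffAt 𝕜 2 f 0)
    (hl : ∀ᶠ y in 𝓝 (0 : E), f (0, y) = y) (hr : ∀ᶠ x in 𝓝 (0 : E), f (x, 0) = x) :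
    ∃ C > 0, ∃ ρ > 0, ∀ x ∈ closedBall (0 : E) ρ, ∀ a ∈ closedBall (0 : E) ρ,
      ∀ y ∈ closedBall (0 : E) ρ, ∀ b ∈ closedBall (0 : E) ρ,
      ‖(f (x, a) - x - a) - (f (y, b) - y - b)‖ ≤ C * (‖a‖ * ‖x - y‖ + ‖y‖ * ‖a - b‖) := by
  obtain ⟨K, s, hs, hK⟩ := (contDiffAt_partialSnd hf).exists_lipschitzOnWith
  have hev : ∀ᶠ p in 𝓝 ((0 : E), (0 : E)), p ∈ s ∧
      HasFDerivAt (fun y => f (p.1, y)) (partialSnd 𝕜 f p) p.2 :=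
    (show ∀ᶠ p in 𝓝 (0 : E × E), p ∈ s from hs).and (eventually_hasFDerivAt_partialSnd hf)
  obtain ⟨t, ht, hev⟩ := hev.exists_nhds_prod_self
  have hev2 : ∀ᶠ x in 𝓝 (0 : E), x ∈ t ∧ partialSnd 𝕜 f (0, x) = ContinuousLinearMap.id 𝕜 E ∧
      f (x, 0) = x :=
    (show ∀ᶠ x in 𝓝 (0 : E), x ∈ t from ht).and
      ((eventually_partialSnd_eq_id hf hl).and hr)
  obtain ⟨ρ, hρ, hb⟩ := nhds_basis_closedBall.mem_iff.1 hev2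
  have h0 : (0 : E) ∈ closedBall (0 : E) ρ := mem_closedBall_self hρ.le
  have hlip : ∀ x ∈ closedBall (0 : E) ρ, ∀ y ∈ closedBall (0 : E) ρ,
      ∀ c ∈ closedBall (0 : E) ρ, ‖partialSnd 𝕜 f (x, c) - partialSnd 𝕜 f (y, c)‖
        ≤ K * ‖x - y‖ := by
    intro x hx y hy c hc
    have := hK.norm_sub_le (hev x (hb hx).1 c (hb hc).1).1 (hev y (hb hy).1 c (hb hc).1).1
    simpa [Prod.norm_def] using this
  refine ⟨K + 1, by positivity, ρ, hρ, fun x hx a ha y hy b hb' => ?_⟩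
  have hd : ∀ x ∈ closedBall (0 : E) ρ, ∀ c ∈ closedBall (0 : E) ρ,
      HasFDerivAt (fun y => f (x, y)) (partialSnd 𝕜 f (x, c)) c :=
    fun x hx c hc => (hev x (hb hx).1 c (hb hc).1).2
  have h1 : ‖(f (x, a) - f (y, a)) - (f (x, 0) - f (y, 0))‖ ≤ K * ‖x - y‖ * ‖a - 0‖ :=
    (convex_closedBall (0 : E) ρ).norm_image_sub_le_of_norm_hasFDerivWithin_le (𝕜 := 𝕜)
      (f := fun c => f (x, c) - f (y, c))
      (fun c hc => ((hd x hx c hc).sub (hd y hy c hc)).hasFDerivWithinAt)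
      (fun c hc => hlip x hx y hy c hc) h0 ha
  have h2 : ‖(f (y, a) - a) - (f (y, b) - b)‖ ≤ K * ‖y‖ * ‖a - b‖ :=
    (convex_closedBall (0 : E) ρ).norm_image_sub_le_of_norm_hasFDerivWithin_le (𝕜 := 𝕜)
      (f := fun c => f (y, c) - c)
      (fun c hc => ((hd y hy c hc).sub (hasFDerivAt_id c)).hasFDerivWithinAt)
      (fun c hc => by
        have := hlip y hy 0 h0 c hc
        rwa [(hb hc).2.1, sub_zero] at this) hb' ha
  rw [(hb hx).2.2, (hb hy).2.2, sub_zero] at h1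
  calc ‖(f (x, a) - x - a) - (f (y, b) - y - b)‖
      = ‖((f (x, a) - f (y, a)) - (x - y)) + ((f (y, a) - a) - (f (y, b) - b))‖ := by
        congr 1; abel
    _ ≤ K * ‖x - y‖ * ‖a‖ + K * ‖y‖ * ‖a - b‖ := (norm_add_le _ _).trans (add_le_add h1 h2)
    _ ≤ (K + 1) * (‖a‖ * ‖x - y‖ + ‖y‖ * ‖a - b‖) := by
        have : 0 ≤ ‖a‖ * ‖x - y‖ + ‖y‖ * ‖a - b‖ := by positivity
        nlinarith

/-- The remainder of a `C²` local product is its mixed second derivative `L` at `0`, up to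
`o(‖x‖ ‖y‖)`. -/
theorem exists_norm_product_sub_le {f : E × E → E} (hf : ContDiffAt 𝕜 2 f 0)
    (hl : ∀ᶠ y in 𝓝 (0 : E), f (0, y) = y) (hr : ∀ᶠ x in 𝓝 (0 : E), f (x, 0) = x)
    {L : E →L[𝕜] E →L[𝕜] E}
    (hL : HasFDerivAt (fun x : E => partialSnd 𝕜 f (x, 0)) L 0)
    {ε : ℝ} (hε : 0 < ε) :
    ∃ ρ > 0, ∀ x ∈ closedBall (0 : E) ρ, ∀ y ∈ closedBall (0 : E) ρ,
      ‖f (x, y) - x - y - L x y‖ ≤ ε * (‖x‖ * ‖y‖) := by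
  have hq : HasStrictFDerivAt (partialSnd 𝕜 f) (fderiv 𝕜 (partialSnd 𝕜 f) 0) 0 :=
    (contDiffAt_partialSnd hf).hasStrictFDerivAt (by norm_num)
  have hLq : ∀ x, L x = fderiv 𝕜 (partialSnd 𝕜 f) 0 (x, 0) := by
    intro x
    have h1 : HasFDerivAt (partialSnd 𝕜 f) (fderiv 𝕜 (partialSnd 𝕜 f) 0) ((0 : E), (0 : E)) :=
      hq.hasFDerivAt
    have h2 := h1.comp (f := fun x : E => (x, (0 : E))) (0 : E)
      (hasFDerivAt_prodMk_left (𝕜 := 𝕜) (0 : E) (0 : E))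
    rw [hL.unique h2]
    simp
  have hev : ∀ᶠ p in 𝓝 ((0 : E), (0 : E)),
      HasFDerivAt (fun y => f (p.1, y)) (partialSnd 𝕜 f p) p.2 :=
    eventually_hasFDerivAt_partialSnd hf
  obtain ⟨t, ht, hev⟩ := hev.exists_nhds_prod_self
  have hs := hq.isLittleO.def hε
  have hs' : ∀ᶠ p in 𝓝 ((0 : E × E), (0 : E × E)), ‖partialSnd 𝕜 f p.1 - partialSnd 𝕜 f p.2
      - fderiv 𝕜 (partialSnd 𝕜 f) 0 (p.1 - p.2)‖ ≤ ε * ‖p.1 - p.2‖ := hs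
  obtain ⟨s, hs, hs'⟩ := hs'.exists_nhds_prod_self
  have hsE : ∀ᶠ p in 𝓝 ((0 : E), (0 : E)), p ∈ s := hs
  obtain ⟨u, hu, hsE⟩ := hsE.exists_nhds_prod_self
  have hev2 : ∀ᶠ x in 𝓝 (0 : E), x ∈ t ∧ x ∈ u ∧
      partialSnd 𝕜 f (0, x) = ContinuousLinearMap.id 𝕜 E ∧ f (x, 0) = x :=
    (show ∀ᶠ x in 𝓝 (0 : E), x ∈ t from ht).and
      ((show ∀ᶠ x in 𝓝 (0 : E), x ∈ u from hu).and
      ((eventually_partialSnd_eq_id hf hl).and hr))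
  obtain ⟨ρ, hρ, hb⟩ := nhds_basis_closedBall.mem_iff.1 hev2
  have h0 : (0 : E) ∈ closedBall (0 : E) ρ := mem_closedBall_self hρ.le
  refine ⟨ρ, hρ, fun x hx y hy => ?_⟩
  have h1 : ‖(f (x, y) - y - L x y) - (f (x, 0) - 0 - L x 0)‖ ≤ ε * ‖x‖ * ‖y - 0‖ :=
    (convex_closedBall (0 : E) ρ).norm_image_sub_le_of_norm_hasFDerivWithin_le (𝕜 := 𝕜)
      (f := fun c => f (x, c) - c - L x c)
      (fun c hc => (((hev x (hb hx).1 c (hb hc).1).sub (hasFDerivAt_id c)).sub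
        (L x).hasFDerivAt).hasFDerivWithinAt)
      (fun c hc => by
        have := hs' (x, c) (hsE x (hb hx).2.1 c (hb hc).2.1) (0, c)
          (hsE 0 (hb h0).2.1 c (hb hc).2.1)
        simp only [Prod.mk_sub_mk, sub_zero, sub_self, (hb hc).2.2.1, ← hLq] at this
        simpa [Prod.norm_def] using this) h0 hy
  rw [(hb hx).2.2.2] at h1
  calc ‖f (x, y) - x - y - L x y‖ = ‖(f (x, y) - y - L x y) - (x - 0 - L x 0)‖ := by
        congr 1; simp; abel
    _ ≤ ε * (‖x‖ * ‖y‖) := by simpa [mul_assoc] using h1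
end LocalProduct

/-! ### Estimates in a chart at the unit of a topological group -/

section GroupChart

variable {G : Type*} [Group G] [TopologicalSpace G]
  {E : Type*} [NormedAddCommGroup E] [NormedSpace ℝ E]

/-- The closed ball of radius `r` about the origin of a chart, as a subset of the manifold. -/
def chartBall (κ : OpenPartialHomeomorph G E) (r : ℝ) : Set G :=
  κ.source ∩ κ ⁻¹' closedBall 0 r

/-- A chart at the unit of a topological group, sending the unit to `0`, in which the group law
differs from addition by a remainder `r` with
`‖r(x, a) - r(y, b)‖ ≤ C (‖a‖ ‖x - y‖ + ‖y‖ ‖a - b‖)` on the ball of radius `ρ`. -/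
structure IsGroupChart (κ : OpenPartialHomeomorph G E) (C ρ : ℝ) : Prop where
  one_mem : 1 ∈ κ.source
  map_one : κ 1 = 0
  const_pos : 0 < C
  radius_pos : 0 < ρ
  closedBall_subset : closedBall 0 ρ ⊆ κ.target
  mul_mem : ∀ x ∈ chartBall κ ρ, ∀ y ∈ chartBall κ ρ, x * y ∈ κ.source
  bound : ∀ x ∈ chartBall κ ρ, ∀ a ∈ chartBall κ ρ, ∀ y ∈ chartBall κ ρ, ∀ b ∈ chartBall κ ρ,
    ‖(κ (x * a) - κ x - κ a) - (κ (y * b) - κ y - κ b)‖ ≤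
      C * (‖κ a‖ * ‖κ x - κ y‖ + ‖κ y‖ * ‖κ a - κ b‖)

/-- `γ` is a one-parameter subgroup whose velocity at `0`, read in the chart `κ`, is `X`. -/
structure IsChartOneParameter (κ : OpenPartialHomeomorph G E) (X : E) (γ : ℝ → G) : Prop where
  continuous : Continuous γ
  map_add : ∀ s t : ℝ, γ (s + t) = γ s * γ t
  tendsto_velocity : Tendsto (fun t : ℝ => t⁻¹ • κ (γ t)) (𝓝[≠] 0) (𝓝 X)

omit [Group G] [NormedSpace ℝ E] in
theorem mem_chartBall {κ : OpenPartialHomeomorph G E} {r : ℝ} {x : G} :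
    x ∈ chartBall κ r ↔ x ∈ κ.source ∧ ‖κ x‖ ≤ r := by
  simp [chartBall]

omit [Group G] [NormedSpace ℝ E] in
theorem chartBall_mono {κ : OpenPartialHomeomorph G E} {r ρ : ℝ} (hr : r ≤ ρ) : chartBall κ r ⊆ chartBall κ ρ :=
  fun _ hx => mem_chartBall.2 ⟨hx.1, (mem_chartBall.1 hx).2.trans hr⟩

namespace IsGroupChart

variable {κ : OpenPartialHomeomorph G E} {C ρ : ℝ} (hκ : IsGroupChart κ C ρ)

include hκ

omit [NormedSpace ℝ E] in
theorem continuousAt_one : ContinuousAt κ 1 := κ.continuousAt hκ.one_mem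

omit [NormedSpace ℝ E] in
theorem tendsto_zero {α : Type*} {l : Filter α} {x : α → G} (hx : Tendsto x l (𝓝 1)) :
    Tendsto (fun n => κ (x n)) l (𝓝 0) := by
  have := hκ.continuousAt_one.tendsto.comp hx
  rwa [hκ.map_one] at this

omit [NormedSpace ℝ E] in
theorem chartBall_mem_nhds {r : ℝ} (hr : 0 < r) : chartBall κ r ∈ 𝓝 (1 : G) :=
  inter_mem (κ.open_source.mem_nhds hκ.one_mem)
    (hκ.continuousAt_one.preimage_mem_nhds (by rw [hκ.map_one]; exact closedBall_mem_nhds 0 hr))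

omit [NormedSpace ℝ E] in
theorem one_mem_chartBall {r : ℝ} (hr : 0 < r) : (1 : G) ∈ chartBall κ r :=
  mem_of_mem_nhds (hκ.chartBall_mem_nhds hr)

theorem isCompact_chartBall [FiniteDimensional ℝ E] {r : ℝ} (hr : r ≤ ρ) :
    IsCompact (chartBall κ r) := by
  have : ProperSpace E := FiniteDimensional.proper ℝ E
  have hsub : closedBall (0 : E) r ⊆ κ.target :=
    (closedBall_subset_closedBall hr).trans hκ.closedBall_subset
  rw [chartBall, ← κ.symm_image_eq_source_inter_preimage hsub]
  exact (isCompact_closedBall 0 r).image_of_continuousOn (κ.continuousOn_symm.mono hsub)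

omit [NormedSpace ℝ E] in
/-- Near the unit the chart controls convergence to the unit. -/
theorem tendsto_one {α : Type*} {l : Filter α} {x : α → G}
    (hx : ∀ᶠ n in l, x n ∈ κ.source) (h : Tendsto (fun n => κ (x n)) l (𝓝 0)) :
    Tendsto x l (𝓝 1) := by
  have h0 : (0 : E) ∈ κ.target := hκ.map_one ▸ κ.map_source hκ.one_mem
  have h1 := (κ.continuousAt_symm h0).tendsto.comp h
  have h2 : κ.symm 0 = 1 := by rw [← hκ.map_one, κ.left_inv hκ.one_mem]
  rw [h2] at h1
  exact h1.congr' (hx.mono fun n hn => κ.left_inv hn)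

omit [NormedSpace ℝ E] in
theorem norm_mul_sub_le {x a : G} (hx : x ∈ chartBall κ ρ) (ha : a ∈ chartBall κ ρ) :
    ‖κ (x * a) - κ x - κ a‖ ≤ C * (‖κ x‖ * ‖κ a‖) := by
  have h1 := hκ.one_mem_chartBall hκ.radius_pos
  have := hκ.bound x hx a ha 1 h1 1 h1
  simpa [hκ.map_one, mul_comm] using this

/-- Powers of an element near the unit are approximated by multiples in the chart. -/
theorem pow_mem_and_norm_le {δ : ℝ} (hδ : 2 * δ ≤ ρ) (hC : 2 * C * δ ≤ 1) {a : G}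
    (ha : a ∈ chartBall κ ρ) (k : ℕ) (hk : k * ‖κ a‖ ≤ δ) :
    a ^ k ∈ chartBall κ (2 * δ) ∧ ‖κ (a ^ k) - (k : ℝ) • κ a‖ ≤ 2 * C * (k * ‖κ a‖) ^ 2 := by
  have hCp := hκ.const_pos
  induction k with
  | zero =>
    have : 0 ≤ δ := by simpa using hk
    refine ⟨mem_chartBall.2 ⟨by simpa using hκ.one_mem, ?_⟩, ?_⟩ <;> simp [hκ.map_one, this]
  | succ k ih =>
    push_cast at hk ⊢
    have hs : 0 ≤ ‖κ a‖ := norm_nonneg _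
    have hk0 : (0 : ℝ) ≤ k := k.cast_nonneg
    have hkδ : k * ‖κ a‖ ≤ δ := le_trans (by nlinarith) hk
    obtain ⟨hm, hn⟩ := ih hkδ
    have hm' := chartBall_mono hδ hm
    have hnk : ‖κ (a ^ k)‖ ≤ 2 * (k * ‖κ a‖) := by
      have h1 : ‖κ (a ^ k)‖ ≤ ‖κ (a ^ k) - (k : ℝ) • κ a‖ + ‖(k : ℝ) • κ a‖ := by
        simpa using norm_add_le (κ (a ^ k) - (k : ℝ) • κ a) ((k : ℝ) • κ a)
      rw [norm_smul, Real.norm_of_nonneg hk0] at h1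
      have h2 : 0 ≤ k * ‖κ a‖ := by positivity
      nlinarith [mul_le_mul_of_nonneg_left hkδ h2]
    have hr := hκ.norm_mul_sub_le hm' ha
    rw [← pow_succ] at hr
    -- The induction closes because `k² + k ≤ (k + 1)²`.
    have key : ‖κ (a ^ (k + 1)) - ((k : ℝ) + 1) • κ a‖ ≤ 2 * C * (((k : ℝ) + 1) * ‖κ a‖) ^ 2 := by
      calc ‖κ (a ^ (k + 1)) - ((k : ℝ) + 1) • κ a‖
          = ‖(κ (a ^ (k + 1)) - κ (a ^ k) - κ a) + (κ (a ^ k) - (k : ℝ) • κ a)‖ := by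
            congr 1; rw [add_smul, one_smul]; abel
        _ ≤ C * (2 * (k * ‖κ a‖) * ‖κ a‖) + 2 * C * (k * ‖κ a‖) ^ 2 :=
            (norm_add_le _ _).trans (add_le_add (hr.trans (by gcongr)) hn)
        _ ≤ _ := by
            have : 0 ≤ C * ‖κ a‖ ^ 2 * (k + 1) := by positivity
            nlinarith
    refine ⟨mem_chartBall.2 ⟨by rw [pow_succ]; exact hκ.mul_mem _ hm' _ ha, ?_⟩, key⟩
    have h1 : ‖κ (a ^ (k + 1))‖ ≤ ‖κ (a ^ (k + 1)) - ((k : ℝ) + 1) • κ a‖ +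
        ‖((k : ℝ) + 1) • κ a‖ := by
      simpa using norm_add_le (κ (a ^ (k + 1)) - ((k : ℝ) + 1) • κ a) (((k : ℝ) + 1) • κ a)
    rw [norm_smul, Real.norm_of_nonneg (by positivity)] at h1
    have h2 : 0 ≤ ((k : ℝ) + 1) * ‖κ a‖ := by positivity
    nlinarith [mul_le_mul_of_nonneg_left hk h2]

/-- Powers of two elements near the unit separate at most linearly in the exponent. -/
theorem norm_pow_sub_pow_le {δ : ℝ} (hδ : 2 * δ ≤ ρ) (hC : 2 * C * δ ≤ 1) {a b : G}
    (ha : a ∈ chartBall κ ρ) (hb : b ∈ chartBall κ ρ) (k : ℕ)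
    (hka : k * ‖κ a‖ ≤ δ) (hkb : k * ‖κ b‖ ≤ δ) :
    ‖κ (a ^ k) - κ (b ^ k)‖ ≤ 4 * k * ‖κ a - κ b‖ := by
  have hCp := hκ.const_pos
  induction k with
  | zero => simp
  | succ k ih =>
    push_cast at hka hkb ⊢
    have hs : 0 ≤ ‖κ a‖ := norm_nonneg _
    have hs' : 0 ≤ ‖κ b‖ := norm_nonneg _
    have hk0 : (0 : ℝ) ≤ k := k.cast_nonneg
    have hka' : k * ‖κ a‖ ≤ δ := le_trans (by nlinarith) hka
    have hkb' : k * ‖κ b‖ ≤ δ := le_trans (by nlinarith) hkb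
    have ih := ih hka' hkb'
    obtain ⟨hma, -⟩ := hκ.pow_mem_and_norm_le hδ hC ha k hka'
    obtain ⟨hmb, -⟩ := hκ.pow_mem_and_norm_le hδ hC hb k hkb'
    have hr := hκ.bound _ (chartBall_mono hδ hma) a ha _ (chartBall_mono hδ hmb) b hb
    rw [← pow_succ, ← pow_succ] at hr
    have hnb := (mem_chartBall.1 hmb).2
    set d := ‖κ a - κ b‖
    have hd : 0 ≤ d := norm_nonneg _
    have hr' : C * (‖κ a‖ * ‖κ (a ^ k) - κ (b ^ k)‖ + ‖κ (b ^ k)‖ * d) ≤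
        C * (‖κ a‖ * (4 * k * d) + 2 * δ * d) := by gcongr
    have e1 : C * (‖κ a‖ * (4 * k * d)) ≤ 2 * d := by
      have : C * (k * ‖κ a‖) ≤ 1 / 2 := by nlinarith
      nlinarith
    have e2 : C * (2 * δ * d) ≤ d := by nlinarith
    calc ‖κ (a ^ (k + 1)) - κ (b ^ (k + 1))‖
        = ‖(κ (a ^ (k + 1)) - κ (a ^ k) - κ a - (κ (b ^ (k + 1)) - κ (b ^ k) - κ b)) +
            (κ (a ^ k) - κ (b ^ k)) + (κ a - κ b)‖ := by congr 1; abel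
      _ ≤ C * (‖κ a‖ * (4 * k * d) + 2 * δ * d) + 4 * k * d + d := by
          refine (norm_add_le _ _).trans (add_le_add ((norm_add_le _ _).trans
            (add_le_add (hr.trans hr') ih)) le_rfl)
      _ ≤ 4 * (k + 1) * d := by nlinarith

section Velocity

variable {α : Type*} {l : Filter α} {x y : α → G} {t : α → ℝ} {X Y : E}

theorem tendsto_smul_mul_sub (hx : Tendsto x l (𝓝 1)) (hy : Tendsto y l (𝓝 1))
    (hX : Tendsto (fun n => (t n)⁻¹ • κ (x n)) l (𝓝 X)) :
    Tendsto (fun n => (t n)⁻¹ • (κ (x n * y n) - κ (x n) - κ (y n))) l (𝓝 0) := by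
  have h0 : Tendsto (fun n => C * (‖(t n)⁻¹ • κ (x n)‖ * ‖κ (y n)‖)) l (𝓝 0) := by
    have := (hX.norm.mul (hκ.tendsto_zero hy).norm).const_mul C
    simpa using this
  refine squeeze_zero_norm' ?_ h0
  filter_upwards [hx (hκ.chartBall_mem_nhds hκ.radius_pos),
    hy (hκ.chartBall_mem_nhds hκ.radius_pos)] with n h1 h2
  rw [norm_smul, norm_smul, mul_assoc, mul_left_comm C]
  gcongr
  exact hκ.norm_mul_sub_le h1 h2

/-- Velocities at the unit add up under multiplication. -/
theorem tendsto_velocity_mul (hx : Tendsto x l (𝓝 1)) (hy : Tendsto y l (𝓝 1))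
    (hX : Tendsto (fun n => (t n)⁻¹ • κ (x n)) l (𝓝 X))
    (hY : Tendsto (fun n => (t n)⁻¹ • κ (y n)) l (𝓝 Y)) :
    Tendsto (fun n => (t n)⁻¹ • κ (x n * y n)) l (𝓝 (X + Y)) := by
  have := ((hκ.tendsto_smul_mul_sub hx hy hX).add hX).add hY
  rw [zero_add] at this
  refine this.congr fun n => ?_
  rw [← smul_add, ← smul_add]
  congr 1
  abel

theorem tendsto_velocity_inv [IsTopologicalGroup G] (hx : Tendsto x l (𝓝 1))
    (hX : Tendsto (fun n => (t n)⁻¹ • κ (x n)) l (𝓝 X)) :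
    Tendsto (fun n => (t n)⁻¹ • κ (x n)⁻¹) l (𝓝 (-X)) := by
  have hx' : Tendsto (fun n => (x n)⁻¹) l (𝓝 1) := by simpa using hx.inv
  have := (hκ.tendsto_smul_mul_sub hx hx' hX).add hX
  rw [zero_add] at this
  refine this.neg.congr fun n => ?_
  rw [← smul_add, ← smul_neg, mul_inv_cancel, hκ.map_one]
  congr 1
  abel

end Velocity

end IsGroupChart

end GroupChart

/-! ### Construction and uniqueness of one-parameter subgroups -/

theorem tendsto_zpow_one_of_abs_le_one {G : Type*} [Group G] [TopologicalSpace G]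
    [IsTopologicalGroup G] {α : Type*} {l : Filter α} {h : α → G} (hh : Tendsto h l (𝓝 1))
    {e : α → ℤ} (he : ∀ n, |e n| ≤ 1) : Tendsto (fun n => h n ^ e n) l (𝓝 1) := by
  have hi : Tendsto (fun n => (h n)⁻¹) l (𝓝 1) := by simpa using hh.inv
  intro U hU
  rw [mem_map]
  filter_upwards [hh.eventually_mem hU, hi.eventually_mem hU] with n h1 h2
  have := abs_le.1 (he n)
  have h3 : e n = -1 ∨ e n = 0 ∨ e n = 1 := by omega
  rcases h3 with h3 | h3 | h3
  · simpa [h3] using h2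
  · simpa [h3] using mem_of_mem_nhds hU
  · simpa [h3] using h1

section GroupChart

variable {G : Type*} [Group G] [TopologicalSpace G] [IsTopologicalGroup G]
  {E : Type*} [NormedAddCommGroup E] [NormedSpace ℝ E]

section FloorPowers

variable {α : Type*} {l : Filter α} {h : α → G} {t : α → ℝ}

/-- The exponents `⌊s / t⌋` are additive in `s` up to an error in `{-1, 0, 1}`, which does not affect
the limit because `h → 1`. -/
theorem tendsto_zpow_floor_add (hh : Tendsto h l (𝓝 1)) {s s' : ℝ} {g g' : G}
    (hs : Tendsto (fun n => h n ^ ⌊s / t n⌋) l (𝓝 g))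
    (hs' : Tendsto (fun n => h n ^ ⌊s' / t n⌋) l (𝓝 g')) :
    Tendsto (fun n => h n ^ ⌊(s + s') / t n⌋) l (𝓝 (g * g')) := by
  have he : ∀ n, |⌊(s + s') / t n⌋ - (⌊s / t n⌋ + ⌊s' / t n⌋)| ≤ 1 := fun n => by
    have h1 := Int.le_floor_add (s / t n) (s' / t n)
    have h2 := Int.le_floor_add_floor (s / t n) (s' / t n)
    rw [add_div, abs_le]
    omega
  have := (hs.mul hs').mul (tendsto_zpow_one_of_abs_le_one hh he)
  rw [mul_one] at this
  refine this.congr fun n => ?_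
  rw [← zpow_add, ← zpow_add]
  congr 1
  ring

theorem tendsto_zpow_floor_neg (hh : Tendsto h l (𝓝 1)) {s : ℝ} {g : G}
    (hs : Tendsto (fun n => h n ^ ⌊s / t n⌋) l (𝓝 g)) :
    Tendsto (fun n => h n ^ ⌊-s / t n⌋) l (𝓝 g⁻¹) := by
  have he : ∀ n, |⌊-s / t n⌋ + ⌊s / t n⌋| ≤ 1 := fun n => by
    have h1 := Int.le_floor_add (-s / t n) (s / t n)
    have h2 := Int.le_floor_add_floor (-s / t n) (s / t n)
    have h3 : -s / t n + s / t n = 0 := by ring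
    rw [h3, Int.floor_zero] at h1 h2
    rw [abs_le]
    omega
  have := hs.inv.mul (tendsto_zpow_one_of_abs_le_one hh he)
  rw [mul_one] at this
  refine this.congr fun n => ?_
  rw [← zpow_neg, ← zpow_add]
  congr 1
  ring

end FloorPowers

theorem tendsto_nat_floor_mul {α : Type*} {l : Filter α} {t : α → ℝ}
    (ht : Tendsto t l (𝓝[>] 0)) {s : ℝ} (hs : 0 ≤ s) :
    Tendsto (fun n => (⌊s / t n⌋₊ : ℝ) * t n) l (𝓝 s) := by
  have ht0 : Tendsto t l (𝓝 0) := ht.mono_right nhdsWithin_le_nhds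
  have htp : ∀ᶠ n in l, 0 < t n := ht self_mem_nhdsWithin
  have h1 : Tendsto (fun n => s - t n) l (𝓝 s) := by
    simpa using tendsto_const_nhds.sub ht0
  refine tendsto_of_tendsto_of_tendsto_of_le_of_le' h1 tendsto_const_nhds ?_ ?_
  · filter_upwards [htp] with n hn
    have := Nat.lt_floor_add_one (s / t n)
    rw [div_lt_iff₀ hn] at this
    linarith
  · filter_upwards [htp] with n hn
    have := Nat.floor_le (div_nonneg hs hn.le)
    rwa [le_div_iff₀ hn] at this

namespace IsGroupChart

variable {κ : OpenPartialHomeomorph G E} {C ρ : ℝ} (hκ : IsGroupChart κ C ρ)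

include hκ

/-- For a homomorphism `ℝ → G`, continuity and the velocity only have to be checked from the right
of `0`. -/
theorem isChartOneParameter_of_right {X : E} {γ : ℝ → G}
    (hadd : ∀ s t : ℝ, γ (s + t) = γ s * γ t) (h1 : Tendsto γ (𝓝[>] 0) (𝓝 1))
    (hX : Tendsto (fun t : ℝ => t⁻¹ • κ (γ t)) (𝓝[>] 0) (𝓝 X)) :
    IsChartOneParameter κ X γ := by
  have h0 : γ 0 = 1 := by simpa using hadd 0 0
  have hneg : ∀ s, γ (-s) = (γ s)⁻¹ := fun s => by
    rw [eq_inv_iff_mul_eq_one, ← hadd, neg_add_cancel, h0]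
  have hn : Tendsto (fun t : ℝ => -t) (𝓝[<] 0) (𝓝[>] 0) := by
    simpa using tendsto_neg_nhdsLT (a := (0 : ℝ))
  have hleft : Tendsto γ (𝓝[<] 0) (𝓝 1) := by
    have := (h1.comp hn).inv
    rw [inv_one] at this
    refine this.congr fun t => ?_
    rw [Function.comp_apply, hneg, inv_inv]
  have hat : Tendsto γ (𝓝 0) (𝓝 1) := by
    rw [← nhdsNE_sup_pure, ← nhdsLT_sup_nhdsGT]
    refine (hleft.sup h1).sup ?_
    rw [← h0]
    exact tendsto_pure_nhds γ 0
  refine ⟨continuous_iff_continuousAt.2 fun s => ?_, hadd, ?_⟩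
  · have h2 : Tendsto (fun t : ℝ => t - s) (𝓝 s) (𝓝 0) := by
      have : Continuous fun t : ℝ => t - s := by fun_prop
      simpa using this.tendsto s
    have h3 := (hat.comp h2).const_mul (γ s)
    rw [mul_one] at h3
    refine h3.congr fun t => ?_
    rw [Function.comp_apply, ← hadd, add_sub_cancel]
  · rw [← nhdsLT_sup_nhdsGT]
    refine Tendsto.sup ?_ hX
    have := ((hκ.tendsto_velocity_inv h1 hX).comp hn).neg
    rw [neg_neg] at this
    refine this.congr fun t => ?_
    simp [hneg]

omit [IsTopologicalGroup G] [NormedSpace ℝ E] in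
/-- A radius at which the estimates for powers apply. -/
theorem exists_pow_radius : ∃ δ > 0, 2 * δ ≤ ρ ∧ 2 * C * δ ≤ 1 := by
  have hC := hκ.const_pos
  have hρ := hκ.radius_pos
  refine ⟨min (ρ / 2) (1 / (2 * C)), by positivity, ?_, ?_⟩
  · linarith [min_le_left (ρ / 2) (1 / (2 * C))]
  · have := min_le_right (ρ / 2) (1 / (2 * C))
    rwa [le_div_iff₀ (by positivity), mul_comm] at this

/-- Limits of difference quotients of a closed subgroup at the unit are velocities of
one-parameter subgroups: if `h → 1` in `S` and `κ(h) / t → X` with `t → 0⁺`, then an ultrafilter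
limit of `h ^ ⌊s / t⌋` is a one-parameter subgroup of `S` with velocity `X`. -/
theorem exists_oneParameter_of_tendsto [T2Space G] [FiniteDimensional ℝ E] {S : Subgroup G}
    (hS : IsClosed (S : Set G)) {α : Type*} {l : Filter α} [l.NeBot] {h : α → G} {t : α → ℝ}
    (ht : Tendsto t l (𝓝[>] 0)) (hh : Tendsto h l (𝓝 1)) (hhS : ∀ᶠ n in l, h n ∈ S) {X : E}
    (hX : Tendsto (fun n => (t n)⁻¹ • κ (h n)) l (𝓝 X)) :
    ∃ γ, IsChartOneParameter κ X γ ∧ ∀ s, γ s ∈ S := by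
  let F : Ultrafilter α := Ultrafilter.of l
  have hF : (F : Filter α) ≤ l := Ultrafilter.of_le l
  replace ht := ht.mono_left hF
  replace hh := hh.mono_left hF
  replace hhS := hhS.filter_mono hF
  replace hX := hX.mono_left hF
  have hC := hκ.const_pos
  have hρ := hκ.radius_pos
  have htp : ∀ᶠ n in (F : Filter α), 0 < t n := ht self_mem_nhdsWithin
  obtain ⟨δ, hδ0, hδ, hCδ⟩ := hκ.exists_pow_radius
  set M := ‖X‖ + 1
  have hM : 0 < M := by positivity
  have hXM : ∀ᶠ n in (F : Filter α), ‖(t n)⁻¹ • κ (h n)‖ ≤ M :=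
    hX.norm.eventually (ge_mem_nhds (lt_add_one ‖X‖))
  -- For small `s` the powers stay in a compact ball, where the ultrafilter converges.
  have hsmall : ∀ s, 0 ≤ s → s ≤ δ / M → ∃ g ∈ chartBall κ ρ,
      Tendsto (fun n => h n ^ ⌊s / t n⌋) F (𝓝 g) ∧ ‖κ g - s • X‖ ≤ 2 * C * (s * M) ^ 2 := by
    intro s hs0 hs
    rw [le_div_iff₀ hM] at hs
    have hev : ∀ᶠ n in (F : Filter α), h n ^ ⌊s / t n⌋ = h n ^ ⌊s / t n⌋₊ ∧
        h n ^ ⌊s / t n⌋₊ ∈ chartBall κ ρ ∧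
        ‖κ (h n ^ ⌊s / t n⌋₊) - (⌊s / t n⌋₊ : ℝ) • κ (h n)‖ ≤ 2 * C * (s * M) ^ 2 := by
      filter_upwards [htp, hXM, hh (hκ.chartBall_mem_nhds hρ)] with n hn hn2 hn3
      have hk : (⌊s / t n⌋₊ : ℝ) * ‖κ (h n)‖ ≤ s * M := by
        have e1 : (⌊s / t n⌋₊ : ℝ) ≤ s / t n := Nat.floor_le (div_nonneg hs0 hn.le)
        rw [norm_smul, norm_inv, Real.norm_of_nonneg hn.le] at hn2
        calc (⌊s / t n⌋₊ : ℝ) * ‖κ (h n)‖ ≤ s / t n * ‖κ (h n)‖ := by gcongr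
          _ = s * ((t n)⁻¹ * ‖κ (h n)‖) := by ring
          _ ≤ s * M := by gcongr
      obtain ⟨m1, m2⟩ := hκ.pow_mem_and_norm_le hδ hCδ hn3 _ (hk.trans hs)
      refine ⟨?_, chartBall_mono hδ m1, m2.trans (by gcongr)⟩
      rw [← zpow_natCast, Int.natCast_floor_eq_floor (div_nonneg hs0 hn.le)]
    obtain ⟨g, hg, hlim⟩ := (hκ.isCompact_chartBall le_rfl).ultrafilter_le_nhds
      (F.map fun n => h n ^ ⌊s / t n⌋₊)
      (le_principal_iff.2 (hev.mono fun n hn => hn.2.1))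
    have hlim' : Tendsto (fun n => h n ^ ⌊s / t n⌋₊) F (𝓝 g) := hlim
    refine ⟨g, hg, hlim'.congr' (hev.mono fun n hn => hn.1.symm), ?_⟩
    have e1 := (κ.continuousAt hg.1).tendsto.comp hlim'
    have e2 : Tendsto (fun n => (⌊s / t n⌋₊ : ℝ) • κ (h n)) F (𝓝 (s • X)) := by
      refine ((tendsto_nat_floor_mul ht hs0).smul hX).congr' ?_
      filter_upwards [htp] with n hn
      rw [smul_smul, mul_assoc, mul_inv_cancel₀ hn.ne', mul_one]
    exact le_of_tendsto (e1.sub e2).norm (hev.mono fun n hn => hn.2.2)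
  -- By additivity of the exponents, convergence for small `s` gives convergence for all `s`.
  have hall : ∀ s : ℝ, ∃ g, Tendsto (fun n => h n ^ ⌊s / t n⌋) F (𝓝 g) := by
    have hpos : ∀ s : ℝ, 0 ≤ s → ∃ g, Tendsto (fun n => h n ^ ⌊s / t n⌋) F (𝓝 g) := by
      intro s hs
      obtain ⟨N, hN⟩ := exists_nat_gt (s / (δ / M))
      have hN0 : (0 : ℝ) < N := lt_of_le_of_lt (by positivity) hN
      obtain ⟨g, -, hg, -⟩ := hsmall (s / N) (by positivity) (by
        rw [div_lt_iff₀ (by positivity)] at hN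
        rw [div_le_iff₀ hN0]
        linarith)
      have hmul : ∀ k : ℕ, ∃ g, Tendsto (fun n => h n ^ ⌊(k * (s / N)) / t n⌋) F (𝓝 g) := by
        intro k
        induction k with
        | zero => exact ⟨1, by simp⟩
        | succ k ih =>
          obtain ⟨g', hg'⟩ := ih
          refine ⟨g' * g, ?_⟩
          have := tendsto_zpow_floor_add hh hg' hg
          simpa [add_mul] using this
      have e : N * (s / N) = s := by field_simp
      simpa only [e] using hmul N
    intro s
    rcases le_total 0 s with hs | hs
    · exact hpos s hs
    · obtain ⟨g, hg⟩ := hpos (-s) (by linarith)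
      exact ⟨g⁻¹, by simpa using tendsto_zpow_floor_neg hh hg⟩
  choose γ hγ using hall
  have hest : ∀ s, 0 ≤ s → s ≤ δ / M →
      γ s ∈ chartBall κ ρ ∧ ‖κ (γ s) - s • X‖ ≤ 2 * C * (s * M) ^ 2 := by
    intro s hs0 hs
    obtain ⟨g, hg, hlim, hb⟩ := hsmall s hs0 hs
    rw [tendsto_nhds_unique (hγ s) hlim]
    exact ⟨hg, hb⟩
  have hev : ∀ᶠ s : ℝ in 𝓝[>] 0, 0 < s ∧ s ≤ δ / M := by
    filter_upwards [self_mem_nhdsWithin,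
      nhdsWithin_le_nhds (Iic_mem_nhds (show (0 : ℝ) < δ / M by positivity))] with s h1 h2
    exact ⟨h1, h2⟩
  have hid : Tendsto (fun s : ℝ => s) (𝓝[>] 0) (𝓝 0) := nhdsWithin_le_nhds
  have hvel : Tendsto (fun s : ℝ => s⁻¹ • κ (γ s)) (𝓝[>] 0) (𝓝 X) := by
    rw [tendsto_iff_norm_sub_tendsto_zero]
    have hz : Tendsto (fun s : ℝ => 2 * C * M ^ 2 * s) (𝓝[>] 0) (𝓝 0) := by
      simpa using hid.const_mul (2 * C * M ^ 2)
    refine squeeze_zero' (Eventually.of_forall fun _ => norm_nonneg _) ?_ hz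
    filter_upwards [hev] with s hs
    have e : s⁻¹ • κ (γ s) - X = s⁻¹ • (κ (γ s) - s • X) := by
      rw [smul_sub, smul_smul, inv_mul_cancel₀ hs.1.ne', one_smul]
    rw [e, norm_smul, norm_inv, Real.norm_of_nonneg hs.1.le, inv_mul_le_iff₀ hs.1]
    exact (hest s hs.1.le hs.2).2.trans_eq (by ring)
  refine ⟨γ, hκ.isChartOneParameter_of_right
    (fun s s' => tendsto_nhds_unique (hγ _) (tendsto_zpow_floor_add hh (hγ s) (hγ s'))) ?_ hvel,
    fun s => hS.mem_of_tendsto (hγ s) (hhS.mono fun n hn => S.zpow_mem hn _)⟩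
  refine hκ.tendsto_one (hev.mono fun s hs => (hest s hs.1.le hs.2).1.1) ?_
  have := hid.smul hvel
  rw [zero_smul] at this
  refine this.congr' ?_
  filter_upwards [hev] with s hs
  rw [smul_smul, mul_inv_cancel₀ hs.1.ne', one_smul]

end IsGroupChart

namespace IsChartOneParameter

variable {κ : OpenPartialHomeomorph G E} {C ρ : ℝ} {X : E} {γ : ℝ → G}

omit [IsTopologicalGroup G] in
theorem map_zero (h : IsChartOneParameter κ X γ) : γ 0 = 1 := by simpa using h.map_add 0 0

omit [IsTopologicalGroup G] in
theorem map_natCast_mul (h : IsChartOneParameter κ X γ) (n : ℕ) (t : ℝ) :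
    γ (n * t) = γ t ^ n := by
  induction n with
  | zero => simp [h.map_zero]
  | succ n ih => rw [pow_succ, ← ih, ← h.map_add]; congr 1; push_cast; ring

omit [IsTopologicalGroup G] in
theorem tendsto_one (h : IsChartOneParameter κ X γ) : Tendsto γ (𝓝 0) (𝓝 1) :=
  h.map_zero ▸ h.continuous.tendsto 0

omit [IsTopologicalGroup G] in
/-- A one-parameter subgroup is determined near `0` by its velocity. -/
theorem eventually_eq (hκ : IsGroupChart κ C ρ) {γ' : ℝ → G}
    (h : IsChartOneParameter κ X γ) (h' : IsChartOneParameter κ X γ') :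
    ∀ᶠ t in 𝓝 (0 : ℝ), γ t = γ' t := by
  have hC := hκ.const_pos
  have hρ := hκ.radius_pos
  obtain ⟨δ, hδ0, hδ, hCδ⟩ := hκ.exists_pow_radius
  set M := ‖X‖ + 1
  have hM : 0 < M := by positivity
  have hsmall : ∀ᶠ t : ℝ in 𝓝 0, |t| * M < δ := by
    have : Continuous fun t : ℝ => |t| * M := by fun_prop
    exact this.tendsto 0 |>.eventually (gt_mem_nhds (by simpa using hδ0))
  filter_upwards [hsmall, h.tendsto_one (κ.open_source.mem_nhds hκ.one_mem),
    h'.tendsto_one (κ.open_source.mem_nhds hκ.one_mem)] with t ht hm hm'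
  rcases eq_or_ne t 0 with rfl | ht0
  · rw [h.map_zero, h'.map_zero]
  have hlim : Tendsto (fun n : ℕ => t / n) atTop (𝓝[≠] 0) := by
    refine tendsto_nhdsWithin_iff.2 ⟨tendsto_const_div_atTop_nhds_zero_nat t, ?_⟩
    filter_upwards [eventually_gt_atTop 0] with n hn
    have : (n : ℝ) ≠ 0 := by positivity
    exact div_ne_zero ht0 this
  -- Both curves are compared through `γ t = γ (t / n) ^ n`.
  have key : ∀ {γ : ℝ → G}, IsChartOneParameter κ X γ → ∀ᶠ n : ℕ in atTop,
      γ t = γ (t / n) ^ n ∧ γ (t / n) ∈ chartBall κ ρ ∧ n * ‖κ (γ (t / n))‖ ≤ δ := by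
    intro γ h
    have hle := (h.tendsto_velocity.comp hlim).norm.eventually (ge_mem_nhds (lt_add_one ‖X‖))
    have h1 := (h.tendsto_one.mono_left nhdsWithin_le_nhds).comp hlim
    filter_upwards [eventually_gt_atTop 0, hle, h1.eventually_mem (hκ.chartBall_mem_nhds hρ)]
      with n hn hle hmem
    have hn' : (0 : ℝ) < n := by positivity
    refine ⟨?_, hmem, ?_⟩
    · rw [← h.map_natCast_mul]
      congr 1
      field_simp
    · simp only [Function.comp_apply, norm_smul, norm_inv, norm_div, Real.norm_eq_abs,
        Nat.abs_cast] at hle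
      have : |t| * ((|t| / n)⁻¹ * ‖κ (γ (t / n))‖) ≤ |t| * M := by gcongr
      have ht' : |t| ≠ 0 := abs_ne_zero.2 ht0
      calc n * ‖κ (γ (t / n))‖ = |t| * ((|t| / n)⁻¹ * ‖κ (γ (t / n))‖) := by field_simp
        _ ≤ δ := this.trans ht.le
  have hz : Tendsto (fun n : ℕ => 4 * |t| *
      ‖(t / n)⁻¹ • κ (γ (t / n)) - (t / n)⁻¹ • κ (γ' (t / n))‖) atTop (𝓝 0) := by
    have := (((h.tendsto_velocity.comp hlim).sub
      (h'.tendsto_velocity.comp hlim)).norm).const_mul (4 * |t|)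
    simpa using this
  have hle : ∀ᶠ n : ℕ in atTop, ‖κ (γ t) - κ (γ' t)‖ ≤ 4 * |t| *
      ‖(t / n)⁻¹ • κ (γ (t / n)) - (t / n)⁻¹ • κ (γ' (t / n))‖ := by
    filter_upwards [key h, key h', eventually_gt_atTop 0] with n h1 h2 hn
    have hn' : (0 : ℝ) < n := by positivity
    have ht' : |t| ≠ 0 := abs_ne_zero.2 ht0
    have := hκ.norm_pow_sub_pow_le hδ hCδ h1.2.1 h2.2.1 n h1.2.2 h2.2.2
    rw [← h1.1, ← h2.1] at this
    refine this.trans_eq ?_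
    rw [← smul_sub, norm_smul, norm_inv, norm_div, Real.norm_eq_abs, Real.norm_natCast]
    field_simp
  have h0 : ‖κ (γ t) - κ (γ' t)‖ ≤ 0 := ge_of_tendsto hz hle
  exact κ.injOn hm hm' (sub_eq_zero.1 (norm_le_zero_iff.1 h0))

end IsChartOneParameter

end GroupChart

/-! ### The tangent space of a closed subgroup -/

section GroupChart

variable {G : Type*} [Group G] [TopologicalSpace G] [IsTopologicalGroup G]
  {E : Type*} [NormedAddCommGroup E] [NormedSpace ℝ E]
  {κ : OpenPartialHomeomorph G E} {C ρ : ℝ}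

omit [IsTopologicalGroup G] in
/-- If `x = q z` with `q, z → 1`, then the difference quotients of `x` and `z` in the chart have
the same limit as those of `q` at the unit. -/
theorem IsGroupChart.tendsto_velocity_of_sub (hκ : IsGroupChart κ C ρ) {α : Type*} {l : Filter α}
    {q z : α → G} {t : α → ℝ} {W : E} (hq : Tendsto q l (𝓝 1)) (hz : Tendsto z l (𝓝 1))
    (hW : Tendsto (fun n => (t n)⁻¹ • (κ (q n * z n) - κ (z n))) l (𝓝 W)) :
    Tendsto (fun n => (t n)⁻¹ • κ (q n)) l (𝓝 W) := by
  have hC := hκ.const_pos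
  have hz0 := (hκ.tendsto_zero hz).norm.const_mul C
  rw [norm_zero, mul_zero] at hz0
  have h0 : Tendsto (fun n => (C * ‖κ (z n)‖) * (2 * ‖(t n)⁻¹ • (κ (q n * z n) - κ (z n))‖)) l
      (𝓝 0) := by
    simpa using hz0.mul (hW.norm.const_mul 2)
  have h1 : Tendsto (fun n => (t n)⁻¹ • (κ (q n * z n) - κ (z n)) - (t n)⁻¹ • κ (q n)) l
      (𝓝 0) := by
    refine squeeze_zero_norm' ?_ h0
    filter_upwards [hq.eventually_mem (hκ.chartBall_mem_nhds hκ.radius_pos),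
      hz.eventually_mem (hκ.chartBall_mem_nhds hκ.radius_pos),
      hz0.eventually (ge_mem_nhds (show (0 : ℝ) < 1 / 2 by norm_num))] with n h1 h2 h3
    have h4 := hκ.norm_mul_sub_le h1 h2
    have h5 : ‖κ (q n)‖ ≤ 2 * ‖κ (q n * z n) - κ (z n)‖ := by
      have := norm_sub_le (κ (q n * z n) - κ (z n)) (κ (q n * z n) - κ (q n) - κ (z n))
      have e : κ (q n * z n) - κ (z n) - (κ (q n * z n) - κ (q n) - κ (z n)) = κ (q n) := by abel
      rw [e] at this
      nlinarith [norm_nonneg (κ (q n))]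
    rw [← smul_sub, norm_smul, norm_smul]
    calc ‖(t n)⁻¹‖ * ‖κ (q n * z n) - κ (z n) - κ (q n)‖
        ≤ ‖(t n)⁻¹‖ * (C * (2 * ‖κ (q n * z n) - κ (z n)‖ * ‖κ (z n)‖)) := by
          gcongr
          rw [sub_right_comm]
          exact h4.trans (by gcongr)
      _ = _ := by ring
  have := hW.sub h1
  rw [sub_zero] at this
  exact this.congr fun n => sub_sub_cancel _ _

/-- The velocities of the one-parameter subgroups of `G` that lie in `S`. -/
def chartTangent (κ : OpenPartialHomeomorph G E) (S : Subgroup G) : Set E :=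
  {X | ∃ γ, IsChartOneParameter κ X γ ∧ ∀ t, γ t ∈ S}

omit [IsTopologicalGroup G] in
theorem smul_mem_chartTangent (hκ : IsGroupChart κ C ρ) {S : Subgroup G} (c : ℝ) {X : E}
    (hX : X ∈ chartTangent κ S) : c • X ∈ chartTangent κ S := by
  obtain ⟨γ, hγ, hS⟩ := hX
  refine ⟨fun t => γ (c * t), ⟨hγ.continuous.comp (by fun_prop),
    fun s t => by rw [mul_add, hγ.map_add], ?_⟩, fun t => hS _⟩
  rcases eq_or_ne c 0 with rfl | hc
  · simp [hγ.map_zero, hκ.map_one]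
  · have hl : Tendsto (fun t : ℝ => c * t) (𝓝[≠] 0) (𝓝[≠] 0) := by
      refine tendsto_nhdsWithin_iff.2 ⟨?_, ?_⟩
      · have : Continuous fun t : ℝ => c * t := by fun_prop
        simpa using this.continuousWithinAt.tendsto (s := {0}ᶜ) (x := 0)
      · filter_upwards [self_mem_nhdsWithin] with t ht using mul_ne_zero hc ht
    refine ((hγ.tendsto_velocity.comp hl).const_smul c).congr fun t => ?_
    simp only [Function.comp_apply, smul_smul]
    congr 1
    rw [mul_inv, mul_inv_cancel_left₀ hc]

variable [T2Space G] [FiniteDimensional ℝ E]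

theorem add_mem_chartTangent (hκ : IsGroupChart κ C ρ) {S : Subgroup G}
    (hS : IsClosed (S : Set G)) {X Y : E}
    (hX : X ∈ chartTangent κ S) (hY : Y ∈ chartTangent κ S) : X + Y ∈ chartTangent κ S := by
  obtain ⟨γ, hγ, hγS⟩ := hX
  obtain ⟨η, hη, hηS⟩ := hY
  have hle : 𝓝[>] (0 : ℝ) ≤ 𝓝[≠] 0 := nhdsWithin_mono _ fun t ht => ne_of_gt ht
  have h1 := hγ.tendsto_one.mono_left (nhdsWithin_le_nhds (s := Ioi 0))
  have h2 := hη.tendsto_one.mono_left (nhdsWithin_le_nhds (s := Ioi 0))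
  exact hκ.exists_oneParameter_of_tendsto hS (t := fun t : ℝ => t) tendsto_id
    (by simpa using h1.mul h2) (Eventually.of_forall fun t => S.mul_mem (hγS t) (hηS t))
    (hκ.tendsto_velocity_mul h1 h2 (hγ.tendsto_velocity.mono_left hle)
      (hη.tendsto_velocity.mono_left hle))

/-- The tangent space at the unit of a closed subgroup, as a real vector space. -/
def chartTangentSubmodule (hκ : IsGroupChart κ C ρ) {S : Subgroup G}
    (hS : IsClosed (S : Set G)) : Submodule ℝ E where
  carrier := chartTangent κ S
  zero_mem' := ⟨fun _ => 1, ⟨continuous_const, by simp, by simp [hκ.map_one]⟩,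
    fun _ => S.one_mem⟩
  add_mem' := add_mem_chartTangent hκ hS
  smul_mem' := fun c _ => smul_mem_chartTangent hκ c

/-- The velocity of the commutators `γ(t) η(t) γ(t)⁻¹ η(t)⁻¹`, in the parameter `t²`, is the
antisymmetrization of the quadratic part of the group law. -/
theorem bracket_mem_chartTangent (hκ : IsGroupChart κ C ρ) {S : Subgroup G}
    (hS : IsClosed (S : Set G)) {L : E →L[ℝ] E →L[ℝ] E}
    (hL : ∀ ε > 0, ∃ r > 0, ∀ x ∈ chartBall κ r, ∀ y ∈ chartBall κ r,
      ‖κ (x * y) - κ x - κ y - L (κ x) (κ y)‖ ≤ ε * (‖κ x‖ * ‖κ y‖)) {X Y : E}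
    (hX : X ∈ chartTangent κ S) (hY : Y ∈ chartTangent κ S) :
    L X Y - L Y X ∈ chartTangent κ S := by
  obtain ⟨γ, hγ, hγS⟩ := hX
  obtain ⟨η, hη, hηS⟩ := hY
  have hquad : ∀ {X Y : E} {γ η : ℝ → G}, IsChartOneParameter κ X γ → IsChartOneParameter κ Y η →
      Tendsto (fun t : ℝ => (t ^ 2)⁻¹ • (κ (γ t * η t) - κ (γ t) - κ (η t))) (𝓝[>] 0)
        (𝓝 (L X Y)) := by
    intro X Y γ η hγ hη
    have hle : 𝓝[>] (0 : ℝ) ≤ 𝓝[≠] 0 := nhdsWithin_mono _ fun t ht => ne_of_gt ht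
    have hX := hγ.tendsto_velocity.mono_left hle
    have hY := hη.tendsto_velocity.mono_left hle
    have h1 := hγ.tendsto_one.mono_left (nhdsWithin_le_nhds (s := Ioi 0))
    have h2 := hη.tendsto_one.mono_left (nhdsWithin_le_nhds (s := Ioi 0))
    have hLt : Tendsto (fun t : ℝ => (t ^ 2)⁻¹ • L (κ (γ t)) (κ (η t))) (𝓝[>] 0)
        (𝓝 (L X Y)) := by
      have hc : Tendsto (fun p : E × E => L p.1 p.2) (𝓝 (X, Y)) (𝓝 (L X Y)) :=
        (show Continuous fun p : E × E => L p.1 p.2 by fun_prop).tendsto (X, Y)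
      refine (hc.comp (hX.prodMk_nhds hY)).congr fun t => ?_
      simp only [Function.comp_apply, map_smul, smul_apply, smul_smul]
      congr 1
      rw [pow_two, mul_inv]
    have hrem : Tendsto (fun t : ℝ => (t ^ 2)⁻¹ •
        (κ (γ t * η t) - κ (γ t) - κ (η t) - L (κ (γ t)) (κ (η t)))) (𝓝[>] 0) (𝓝 0) := by
      have hb := hX.norm.mul hY.norm
      have hb1 := hb.eventually (ge_mem_nhds (lt_add_one _))
      set M := ‖X‖ * ‖Y‖ + 1
      have hM : 0 < M := by positivity
      rw [Metric.tendsto_nhds]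
      intro ε hε
      obtain ⟨r, hr, hLr⟩ := hL (ε / (2 * M)) (by positivity)
      filter_upwards [hb1, h1.eventually_mem (hκ.chartBall_mem_nhds hr),
        h2.eventually_mem (hκ.chartBall_mem_nhds hr)] with t ht hx hy
      rw [dist_zero_right, norm_smul]
      have := hLr _ hx _ hy
      rw [norm_smul, norm_smul] at ht
      calc ‖(t ^ 2)⁻¹‖ * ‖κ (γ t * η t) - κ (γ t) - κ (η t) - L (κ (γ t)) (κ (η t))‖
          ≤ ‖(t ^ 2)⁻¹‖ * (ε / (2 * M) * (‖κ (γ t)‖ * ‖κ (η t)‖)) := by gcongr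
        _ = ε / (2 * M) * (‖t⁻¹‖ * ‖κ (γ t)‖ * (‖t⁻¹‖ * ‖κ (η t)‖)) := by
            rw [pow_two, mul_inv, norm_mul]; ring
        _ ≤ ε / (2 * M) * M := by gcongr
        _ = ε / 2 := by field_simp
        _ < ε := by linarith
    have := hrem.add hLt
    rw [zero_add] at this
    refine this.congr fun t => ?_
    rw [← smul_add, sub_add_cancel]
  have h1 := hγ.tendsto_one.mono_left (nhdsWithin_le_nhds (s := Ioi 0))
  have h2 := hη.tendsto_one.mono_left (nhdsWithin_le_nhds (s := Ioi 0))
  have hq : Tendsto (fun t => γ t * η t * (η t * γ t)⁻¹) (𝓝[>] 0) (𝓝 1) := by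
    simpa using (h1.mul h2).mul (h2.mul h1).inv
  have hz : Tendsto (fun t => η t * γ t) (𝓝[>] 0) (𝓝 1) := by simpa using h2.mul h1
  have ht : Tendsto (fun t : ℝ => t ^ 2) (𝓝[>] 0) (𝓝[>] 0) := by
    refine tendsto_nhdsWithin_iff.2 ⟨?_, ?_⟩
    · have : Continuous fun t : ℝ => t ^ 2 := by fun_prop
      simpa using this.continuousWithinAt.tendsto (s := Ioi 0) (x := 0)
    · filter_upwards [self_mem_nhdsWithin] with t ht using pow_pos (mem_Ioi.1 ht) 2
  refine hκ.exists_oneParameter_of_tendsto hS ht hq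
    (Eventually.of_forall fun t => S.mul_mem (S.mul_mem (hγS t) (hηS t))
      (S.inv_mem (S.mul_mem (hηS t) (hγS t)))) (hκ.tendsto_velocity_of_sub hq hz ?_)
  refine ((hquad hγ hη).sub (hquad hη hγ)).congr fun t => ?_
  rw [inv_mul_cancel_right, ← smul_sub]
  congr 1
  abel

/-- Near the unit, a closed subgroup is a Lipschitz graph over its tangent space: a linear map `P`
that is injective on the tangent space is bi-Lipschitz on the subgroup, read in the chart. -/
theorem exists_antilipschitz_on_chartBall (hκ : IsGroupChart κ C ρ) {S : Subgroup G}
    (hS : IsClosed (S : Set G)) {F : Type*} [NormedAddCommGroup F] [NormedSpace ℝ F]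
    (P : E →L[ℝ] F) (hP : ∀ X ∈ chartTangent κ S, P X = 0 → X = 0) :
    ∃ K > 0, ∃ r > 0, r ≤ ρ ∧ ∀ x ∈ chartBall κ r, ∀ y ∈ chartBall κ r, x ∈ S → y ∈ S →
      ‖κ x - κ y‖ ≤ K * ‖P (κ x) - P (κ y)‖ := by
  -- Otherwise the normalized differences of suitable `x, y → 1` in `S` have a limit `v` of norm `1`
  -- with `P v = 0`. It is also the limit for `x y⁻¹`, so `v` is tangent to `S`.
  by_contra! hcon
  have hρ := hκ.radius_pos
  have hr : ∀ n : ℕ, ρ / (n + 1) ≤ ρ := fun n => div_le_self hρ.le (by simp)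
  choose x hx y hy hxS hyS hlt using fun n : ℕ =>
    hcon (n + 1) (by positivity) (ρ / (n + 1)) (by positivity) (hr n)
  have hlim : Tendsto (fun n : ℕ => ρ / ((n : ℝ) + 1)) atTop (𝓝 0) := by
    have := tendsto_one_div_add_atTop_nhds_zero_nat (𝕜 := ℝ) |>.const_mul ρ
    simpa [div_eq_mul_inv] using this
  have h1 : ∀ {x : ℕ → G}, (∀ n : ℕ, x n ∈ chartBall κ (ρ / (n + 1))) →
      Tendsto x atTop (𝓝 1) := fun hx =>
    hκ.tendsto_one (Eventually.of_forall fun n => (hx n).1)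
      (squeeze_zero_norm (fun n => (mem_chartBall.1 (hx n)).2) hlim)
  have hx1 := h1 hx
  have hy1 := h1 hy
  set t : ℕ → ℝ := fun n => ‖κ (x n) - κ (y n)‖ with ht_def
  have htp : ∀ n, 0 < t n := fun n => lt_of_le_of_lt (by positivity) (hlt n)
  have ht : Tendsto t atTop (𝓝[>] 0) := by
    refine tendsto_nhdsWithin_iff.2 ⟨?_, Eventually.of_forall htp⟩
    simpa using ((hκ.tendsto_zero hx1).sub (hκ.tendsto_zero hy1)).norm
  set u : ℕ → E := fun n => (t n)⁻¹ • (κ (x n) - κ (y n)) with hu_def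
  have hu : ∀ n, u n ∈ sphere (0 : E) 1 := fun n => by
    rw [mem_sphere_zero_iff_norm, norm_smul, norm_inv, Real.norm_of_nonneg (htp n).le]
    exact inv_mul_cancel₀ (htp n).ne'
  have : ProperSpace E := FiniteDimensional.proper ℝ E
  obtain ⟨v, hv, φ, hφ, hlimv⟩ := (isCompact_sphere (0 : E) 1).tendsto_subseq hu
  have hφt := hφ.tendsto_atTop
  have hq : Tendsto (fun n => x (φ n) * (y (φ n))⁻¹) atTop (𝓝 1) := by
    simpa using (hx1.comp hφt).mul (hy1.comp hφt).inv
  have hvS : v ∈ chartTangent κ S := by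
    refine hκ.exists_oneParameter_of_tendsto hS (ht.comp hφt) hq
      (Eventually.of_forall fun n => S.mul_mem (hxS _) (S.inv_mem (hyS _)))
      (hκ.tendsto_velocity_of_sub hq (hy1.comp hφt) ?_)
    simpa [hu_def, Function.comp_def] using hlimv
  have hPv : P v = 0 := by
    have h2 : Tendsto (fun n => P (u n)) atTop (𝓝 0) := by
      refine squeeze_zero_norm (fun n => ?_)
        (tendsto_one_div_add_atTop_nhds_zero_nat (𝕜 := ℝ))
      have hl := hlt n
      rw [hu_def]
      simp only [map_smul, map_sub]
      rw [norm_smul, norm_inv, Real.norm_of_nonneg (htp n).le, inv_mul_le_iff₀ (htp n),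
        mul_one_div, le_div_iff₀ (by positivity), mul_comm]
      exact hl.le
    exact tendsto_nhds_unique ((P.continuous.tendsto v).comp hlimv) (h2.comp hφt)
  have hv0 := hP v hvS hPv
  rw [hv0] at hv
  simp at hv

end GroupChart

/-! ### The chart at the unit of a Lie group -/

section UnitChart

variable (E : Type*) [NormedAddCommGroup E] (G : Type*) [Group G] [TopologicalSpace G]
  [ChartedSpace E G]

/-- The preferred chart at the unit, translated so that it sends the unit to `0`. -/
noncomputable def unitChart : OpenPartialHomeomorph G E :=
  (chartAt E (1 : G)).transHomeomorph (Homeomorph.addRight (-chartAt E (1 : G) 1))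

/-- The group law read in the chart at the unit. -/
noncomputable def chartMul (p : E × E) : E :=
  unitChart E G ((unitChart E G).symm p.1 * (unitChart E G).symm p.2)

variable {E G}

theorem unitChart_apply (g : G) :
    unitChart E G g = chartAt E (1 : G) g - chartAt E (1 : G) (1 : G) := by
  simp [unitChart, sub_eq_add_neg]

theorem unitChart_symm_apply (u : E) :
    (unitChart E G).symm u = (chartAt E (1 : G)).symm (u + chartAt E (1 : G) (1 : G)) := by
  simp [unitChart, Homeomorph.addRight_symm]

theorem unitChart_source : (unitChart E G).source = (chartAt E (1 : G)).source := by
  simp [unitChart]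

theorem one_mem_unitChart_source : (1 : G) ∈ (unitChart E G).source := by
  simp [unitChart_source]

theorem unitChart_one : unitChart E G 1 = 0 := by simp [unitChart_apply]

theorem zero_mem_unitChart_target : (0 : E) ∈ (unitChart E G).target :=
  unitChart_one (E := E) (G := G) ▸ (unitChart E G).map_source one_mem_unitChart_source

theorem unitChart_symm_zero : (unitChart E G).symm 0 = 1 := by
  rw [← unitChart_one (E := E) (G := G), (unitChart E G).left_inv one_mem_unitChart_source]

theorem mem_unitChart_target {u : E} :
    u ∈ (unitChart E G).target ↔ u + chartAt E (1 : G) (1 : G) ∈ (chartAt E (1 : G)).target := by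
  simp [unitChart, Homeomorph.addRight_symm]

theorem exists_chartBall_subset {U : Set G} (hU : U ∈ 𝓝 (1 : G)) :
    ∃ r > 0, chartBall (unitChart E G) r ⊆ U := by
  have hc := (unitChart E G).continuousAt_symm (zero_mem_unitChart_target (E := E) (G := G))
  have hU' : (unitChart E G).symm ⁻¹' U ∈ 𝓝 0 :=
    hc.preimage_mem_nhds (by rwa [unitChart_symm_zero])
  obtain ⟨r, hr, hsub⟩ := nhds_basis_closedBall.mem_iff.1 hU'
  refine ⟨r, hr, fun x hx => ?_⟩
  have := hsub hx.2
  rwa [mem_preimage, (unitChart E G).left_inv hx.1] at this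

theorem chartMul_unitChart {x y : G} (hx : x ∈ (unitChart E G).source)
    (hy : y ∈ (unitChart E G).source) :
    chartMul E G (unitChart E G x, unitChart E G y) = unitChart E G (x * y) := by
  simp [chartMul, (unitChart E G).left_inv hx, (unitChart E G).left_inv hy]

theorem eventually_chartMul_zero_left : ∀ᶠ y in 𝓝 (0 : E), chartMul E G (0, y) = y := by
  filter_upwards [(unitChart E G).open_target.mem_nhds zero_mem_unitChart_target] with y hy
  simp [chartMul, unitChart_symm_zero, (unitChart E G).right_inv hy]

theorem eventually_chartMul_zero_right : ∀ᶠ x in 𝓝 (0 : E), chartMul E G (x, 0) = x := by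
  filter_upwards [(unitChart E G).open_target.mem_nhds zero_mem_unitChart_target] with y hy
  simp [chartMul, unitChart_symm_zero, (unitChart E G).right_inv hy]

variable {𝕜 : Type*} [RCLike 𝕜] [NormedSpace 𝕜 E] [LieGroup 𝓘(𝕜, E) ∞ G]

theorem contMDiffAt_unitChart {x : G} (hx : x ∈ (unitChart E G).source) :
    ContMDiffAt 𝓘(𝕜, E) 𝓘(𝕜, E) ∞ (unitChart E G) x := by
  have : IsManifold 𝓘(𝕜, E) ∞ G := inferInstance
  have h1 : ContMDiffAt 𝓘(𝕜, E) 𝓘(𝕜, E) ∞ (chartAt E (1 : G)) x :=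
    (contMDiffOn_chart (I := 𝓘(𝕜, E)) (n := ∞) (x := (1 : G))).contMDiffAt
      ((chartAt E (1 : G)).open_source.mem_nhds (by rwa [unitChart_source] at hx))
  have h2 : ContMDiff 𝓘(𝕜, E) 𝓘(𝕜, E) ∞ fun v : E => v - chartAt E (1 : G) (1 : G) :=
    (contDiff_id.sub contDiff_const).contMDiff
  exact (h2.contMDiffAt.comp x h1).congr_of_eventuallyEq
    (Eventually.of_forall unitChart_apply)

theorem contMDiffAt_unitChart_symm {u : E} (hu : u ∈ (unitChart E G).target) :
    ContMDiffAt 𝓘(𝕜, E) 𝓘(𝕜, E) ∞ (unitChart E G).symm u := by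
  have : IsManifold 𝓘(𝕜, E) ∞ G := inferInstance
  have h1 : ContMDiffAt 𝓘(𝕜, E) 𝓘(𝕜, E) ∞ (chartAt E (1 : G)).symm
      (u + chartAt E (1 : G) (1 : G)) :=
    (contMDiffOn_chart_symm (I := 𝓘(𝕜, E)) (n := ∞) (x := (1 : G))).contMDiffAt
      ((chartAt E (1 : G)).open_target.mem_nhds (mem_unitChart_target.1 hu))
  have h2 : ContMDiff 𝓘(𝕜, E) 𝓘(𝕜, E) ∞ fun v : E => v + chartAt E (1 : G) (1 : G) :=
    (contDiff_id.add contDiff_const).contMDiff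
  exact (h1.comp u h2.contMDiffAt).congr_of_eventuallyEq
    (Eventually.of_forall unitChart_symm_apply)

/-- The product of two points near the unit, followed by a right translation, is smooth in the
chart. The translation is needed because only translates of the product reach the chart. -/
theorem contDiffAt_unitChart_mul_mul {p : E × E} (h1 : p.1 ∈ (unitChart E G).target)
    (h2 : p.2 ∈ (unitChart E G).target) (y : G)
    (h : (unitChart E G).symm p.1 * (unitChart E G).symm p.2 * y ∈ (unitChart E G).source) :
    ContDiffAt 𝕜 ∞ (fun p : E × E =>
      unitChart E G ((unitChart E G).symm p.1 * (unitChart E G).symm p.2 * y)) p := by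
  have hf : ContMDiffAt 𝓘(𝕜, E × E) 𝓘(𝕜, E) ∞ (fun p : E × E => (unitChart E G).symm p.1) p :=
    ContMDiffAt.comp p (contMDiffAt_unitChart_symm h1) contDiff_fst.contMDiff.contMDiffAt
  have hs : ContMDiffAt 𝓘(𝕜, E × E) 𝓘(𝕜, E) ∞ (fun p : E × E => (unitChart E G).symm p.2) p :=
    ContMDiffAt.comp p (contMDiffAt_unitChart_symm h2) contDiff_snd.contMDiff.contMDiffAt
  have hm := (hf.mul hs).mul (contMDiffAt_const (c := y))
  exact (ContMDiffAt.comp p (contMDiffAt_unitChart (𝕜 := 𝕜) h) hm).contDiffAt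

variable (𝕜) in
theorem contDiffAt_chartMul : ContDiffAt 𝕜 ∞ (chartMul E G) 0 := by
  have := contDiffAt_unitChart_mul_mul (𝕜 := 𝕜) (p := (0 : E × E)) (G := G)
    zero_mem_unitChart_target zero_mem_unitChart_target 1
    (by simp [unitChart_symm_zero, one_mem_unitChart_source])
  simpa only [mul_one] using! this

omit [RCLike 𝕜] [NormedSpace 𝕜 E] [LieGroup 𝓘(𝕜, E) ∞ G] in
theorem exists_isGroupChart (𝕜 : Type*) [RCLike 𝕜] [NormedSpace 𝕜 E] [LieGroup 𝓘(𝕜, E) ∞ G]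
    [NormedSpace ℝ E] :
    ∃ C ρ : ℝ, IsGroupChart (unitChart E G) C ρ := by
  have hG : IsTopologicalGroup G := topologicalGroup_of_lieGroup 𝓘(𝕜, E) ∞
  obtain ⟨C, hC, ρ₁, hρ₁, hb⟩ := exists_bound_of_contDiffAt_product (𝕜 := 𝕜)
    ((contDiffAt_chartMul 𝕜 (E := E) (G := G)).of_le ENat.LEInfty.out)
    eventually_chartMul_zero_left eventually_chartMul_zero_right
  obtain ⟨ρ₂, hρ₂, hsub⟩ := nhds_basis_closedBall.mem_iff.1
    ((unitChart E G).open_target.mem_nhds zero_mem_unitChart_target)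
  have hmul : ∀ᶠ p : G × G in 𝓝 (1, 1), p.1 * p.2 ∈ (unitChart E G).source :=
    (continuous_mul.tendsto ((1 : G), (1 : G))).eventually
      ((unitChart E G).open_source.mem_nhds (by simpa using one_mem_unitChart_source))
  obtain ⟨U, hU, hUm⟩ := hmul.exists_nhds_prod_self
  obtain ⟨ρ₃, hρ₃, hsub₃⟩ := exists_chartBall_subset (E := E) hU
  have l1 : min ρ₁ (min ρ₂ ρ₃) ≤ ρ₁ := min_le_left _ _
  have l2 : min ρ₁ (min ρ₂ ρ₃) ≤ ρ₂ := (min_le_right _ _).trans (min_le_left _ _)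
  have l3 : min ρ₁ (min ρ₂ ρ₃) ≤ ρ₃ := (min_le_right _ _).trans (min_le_right _ _)
  refine ⟨C, min ρ₁ (min ρ₂ ρ₃), one_mem_unitChart_source, unitChart_one, hC, by positivity,
    (closedBall_subset_closedBall l2).trans hsub,
    fun x hx y hy => hUm x (hsub₃ (chartBall_mono l3 hx)) y (hsub₃ (chartBall_mono l3 hy)),
    fun x hx a ha y hy b hb' => ?_⟩
  have := hb _ (chartBall_mono l1 hx).2 _ (chartBall_mono l1 ha).2 _ (chartBall_mono l1 hy).2 _
    (chartBall_mono l1 hb').2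
  rwa [chartMul_unitChart hx.1 ha.1, chartMul_unitChart hy.1 hb'.1] at this

/-- The quadratic part of the group law at the unit, as a bilinear map. -/
noncomputable def quadraticPart (𝕜 : Type*) [RCLike 𝕜] (E : Type*) [NormedAddCommGroup E]
    [NormedSpace 𝕜 E] (G : Type*) [Group G] [TopologicalSpace G] [ChartedSpace E G] :
    E →L[𝕜] E →L[𝕜] E :=
  fderiv 𝕜 (fun x : E => partialSnd 𝕜 (chartMul E G) (x, 0)) 0

theorem hasFDerivAt_partialSnd_chartMul :
    HasFDerivAt (fun x : E => partialSnd 𝕜 (chartMul E G) (x, 0)) (quadraticPart 𝕜 E G) 0 := by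
  have h1 : ContDiffAt 𝕜 1 (partialSnd 𝕜 (chartMul E G)) ((0 : E), (0 : E)) :=
    contDiffAt_partialSnd ((contDiffAt_chartMul 𝕜).of_le ENat.LEInfty.out)
  have h2 : ContDiffAt 𝕜 1 (fun x : E => (x, (0 : E))) 0 :=
    (contDiff_id.prodMk contDiff_const).contDiffAt
  exact ((h1.comp (f := fun x : E => (x, (0 : E))) (0 : E) h2).differentiableAt (by norm_num)).hasFDerivAt

theorem norm_unitChart_mul_sub_le [NormedSpace ℝ E] (ε : ℝ) (hε : 0 < ε) :
    ∃ r > 0, ∀ x ∈ chartBall (unitChart E G) r, ∀ y ∈ chartBall (unitChart E G) r,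
      ‖unitChart E G (x * y) - unitChart E G x - unitChart E G y -
        quadraticPart 𝕜 E G (unitChart E G x) (unitChart E G y)‖ ≤
        ε * (‖unitChart E G x‖ * ‖unitChart E G y‖) := by
  obtain ⟨r, hr, h⟩ := exists_norm_product_sub_le (𝕜 := 𝕜)
    ((contDiffAt_chartMul 𝕜 (E := E) (G := G)).of_le ENat.LEInfty.out)
    eventually_chartMul_zero_left eventually_chartMul_zero_right
    hasFDerivAt_partialSnd_chartMul hε
  refine ⟨r, hr, fun x hx y hy => ?_⟩
  have := h _ hx.2 _ hy.2
  rwa [chartMul_unitChart hx.1 hy.1] at this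

end UnitChart

/-! ### The Lie bracket in the chart -/

section Bracket

variable {𝕜 : Type*} [RCLike 𝕜] {E : Type*} [NormedAddCommGroup E] [NormedSpace 𝕜 E]
  {G : Type*} [Group G] [TopologicalSpace G] [ChartedSpace E G] [LieGroup 𝓘(𝕜, E) ∞ G]

/-- The derivative at the unit of the left translation by `g`, read in the chart at the unit. -/
theorem hasFDerivAt_chart_mul_left (g : G) (hg : g ∈ (chartAt E (1 : G)).source) :
    HasFDerivAt (fun v : E => extChartAt 𝓘(𝕜, E) (1 : G)
        (g * (extChartAt 𝓘(𝕜, E) (1 : G)).symm v))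
      ((mfderiv 𝓘(𝕜, E) 𝓘(𝕜, E) (extChartAt 𝓘(𝕜, E) (1 : G)) g : E →L[𝕜] E).comp
        (mfderiv 𝓘(𝕜, E) 𝓘(𝕜, E) (g * ·) (1 : G) : E →L[𝕜] E))
      (extChartAt 𝓘(𝕜, E) (1 : G) 1) := by
  have : IsManifold 𝓘(𝕜, E) ∞ G := inferInstance
  have : IsManifold 𝓘(𝕜, E) 1 G := IsManifold.of_le (n := ∞) ENat.LEInfty.out
  set φ := extChartAt 𝓘(𝕜, E) (1 : G)
  have hs : φ.symm (φ 1) = 1 := extChartAt_to_inv 1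
  have h1 : HasMFDerivAt 𝓘(𝕜, E) 𝓘(𝕜, E) φ.symm (φ 1) (ContinuousLinearMap.id 𝕜 E) := by
    have h := (mdifferentiableWithinAt_extChartAt_symm (I := 𝓘(𝕜, E))
      (mem_extChartAt_target (1 : G))).hasMFDerivWithinAt
    rw [mfderivWithin_range_extChartAt_symm] at h
    have hr : range 𝓘(𝕜, E) = univ := by simp
    rw [hr] at h
    exact hasMFDerivWithinAt_univ.1 h
  have h2 : HasMFDerivAt 𝓘(𝕜, E) 𝓘(𝕜, E) (g * ·) (1 : G)
      (mfderiv 𝓘(𝕜, E) 𝓘(𝕜, E) (g * ·) (1 : G)) :=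
    ((contMDiff_mul_left (I := 𝓘(𝕜, E)) (n := ∞) (a := g)).mdifferentiable
      (by simp)).mdifferentiableAt.hasMFDerivAt
  have h3 : HasMFDerivAt 𝓘(𝕜, E) 𝓘(𝕜, E) φ g (mfderiv 𝓘(𝕜, E) 𝓘(𝕜, E) φ g) :=
    (mdifferentiableAt_extChartAt hg).hasMFDerivAt
  have h4 : HasMFDerivAt 𝓘(𝕜, E) 𝓘(𝕜, E) (fun v => g * φ.symm v) (φ 1)
      (mfderiv 𝓘(𝕜, E) 𝓘(𝕜, E) (g * ·) (1 : G) : E →L[𝕜] E) := by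
    obtain ⟨A, hA⟩ : ∃ A : E →L[𝕜] E, A = mfderiv 𝓘(𝕜, E) 𝓘(𝕜, E) (g * ·) (1 : G) := ⟨_, rfl⟩
    rw [← hA] at h2 ⊢
    have h2' : HasMFDerivAt 𝓘(𝕜, E) 𝓘(𝕜, E) (g * ·) (φ.symm (φ 1)) A := by rwa [hs]
    exact (h2'.comp (φ 1) h1).congr_mfderiv A.comp_id
  have h5 : HasMFDerivAt 𝓘(𝕜, E) 𝓘(𝕜, E) φ (g * φ.symm (φ 1))
      (mfderiv 𝓘(𝕜, E) 𝓘(𝕜, E) φ g : E →L[𝕜] E) := by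
    rw [hs, mul_one]
    exact h3
  exact (h5.comp (φ 1) h4).hasFDerivAt

/-- Read in the chart at the unit, the left-invariant vector field of `X` is `x ↦ ∂₂ m (x, 0) X`,
where `m` is the group law. -/
theorem eventually_mpullbackWithin_mulInvariantVectorField (X : GroupLieAlgebra 𝓘(𝕜, E) G) :
    ∀ᶠ z in 𝓝 (chartAt E (1 : G) 1),
    (VectorField.mpullbackWithin 𝓘(𝕜, E) 𝓘(𝕜, E) (extChartAt 𝓘(𝕜, E) (1 : G)).symm
      (mulInvariantVectorField X) (range 𝓘(𝕜, E)) z : E) =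
      partialSnd 𝕜 (chartMul E G) (z - chartAt E (1 : G) 1, 0) (show E from X) := by
  have : IsManifold 𝓘(𝕜, E) ∞ G := inferInstance
  have : IsManifold 𝓘(𝕜, E) 1 G := IsManifold.of_le (n := ∞) ENat.LEInfty.out
  have hc : Tendsto (fun z : E => (z - chartAt E (1 : G) 1, (0 : E)))
      (𝓝 (chartAt E (1 : G) 1)) (𝓝 0) := by
    have : Continuous fun z : E => (z - chartAt E (1 : G) 1, (0 : E)) := by fun_prop
    simpa using! this.tendsto (chartAt E (1 : G) 1)
  have hev := hc.eventually (eventually_hasFDerivAt_partialSnd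
    ((contDiffAt_chartMul 𝕜 (E := E) (G := G)).of_le ENat.LEInfty.out))
  filter_upwards [hev, (chartAt E (1 : G)).open_target.mem_nhds (mem_chart_target E (1 : G))]
    with z h1 hz
  have hz' : z ∈ (extChartAt 𝓘(𝕜, E) (1 : G)).target := by simpa using hz
  set g := (extChartAt 𝓘(𝕜, E) (1 : G)).symm z with hg
  have hgs : g ∈ (chartAt E (1 : G)).source := (chartAt E (1 : G)).map_target hz
  have hinv : (mfderivWithin 𝓘(𝕜, E) 𝓘(𝕜, E) (extChartAt 𝓘(𝕜, E) (1 : G)).symm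
      (range 𝓘(𝕜, E)) z).inverse = mfderiv 𝓘(𝕜, E) 𝓘(𝕜, E) (extChartAt 𝓘(𝕜, E) (1 : G)) g :=
    ContinuousLinearMap.inverse_eq (mfderivWithin_extChartAt_symm_comp_mfderiv_extChartAt hz')
      (mfderiv_extChartAt_comp_mfderivWithin_extChartAt_symm hz')
  rw [VectorField.mpullbackWithin_apply, hinv]
  have h2 := hasFDerivAt_chart_mul_left (𝕜 := 𝕜) g hgs
  have h3 : HasFDerivAt (fun v : E => extChartAt 𝓘(𝕜, E) (1 : G)
        (g * (extChartAt 𝓘(𝕜, E) (1 : G)).symm (v + chartAt E (1 : G) 1)) - chartAt E (1 : G) 1)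
      ((mfderiv 𝓘(𝕜, E) 𝓘(𝕜, E) (extChartAt 𝓘(𝕜, E) (1 : G)) g : E →L[𝕜] E).comp
        (mfderiv 𝓘(𝕜, E) 𝓘(𝕜, E) (g * ·) (1 : G) : E →L[𝕜] E)) 0 := by
    refine HasFDerivAt.sub_const (𝕜 := 𝕜) (chartAt E (1 : G) 1) ?_
    refine (hasFDerivAt_comp_add_right (𝕜 := 𝕜) (f := fun v : E => extChartAt 𝓘(𝕜, E) (1 : G)
        (g * (extChartAt 𝓘(𝕜, E) (1 : G)).symm v)) (chartAt E (1 : G) 1)).2 ?_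
    rw [zero_add]
    exact h2
  have h4 : (fun y : E => chartMul E G (z - chartAt E (1 : G) 1, y)) = fun v : E =>
      extChartAt 𝓘(𝕜, E) (1 : G) (g * (extChartAt 𝓘(𝕜, E) (1 : G)).symm
        (v + chartAt E (1 : G) 1)) - chartAt E (1 : G) 1 := by
    funext v
    simp [chartMul, unitChart_apply, unitChart_symm_apply, hg]
  rw [← h4] at h3
  rw [h1.unique h3]
  rfl

/-- The Lie bracket of left-invariant vector fields is the antisymmetrization of the quadratic part
of the group law in the chart. -/
theorem bracket_eq_quadraticPart [CompleteSpace E] (X Y : GroupLieAlgebra 𝓘(𝕜, E) G) :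
    (⁅X, Y⁆ : GroupLieAlgebra 𝓘(𝕜, E) G) =
      (quadraticPart 𝕜 E G X Y - quadraticPart 𝕜 E G Y X : E) := by
  have : IsManifold 𝓘(𝕜, E) ∞ G := inferInstance
  have : IsManifold 𝓘(𝕜, E) 1 G := IsManifold.of_le (n := ∞) ENat.LEInfty.out
  have hV : ∀ X : E, HasFDerivAt (VectorField.mpullbackWithin 𝓘(𝕜, E) 𝓘(𝕜, E)
      (extChartAt 𝓘(𝕜, E) (1 : G)).symm
      (mulInvariantVectorField (X : GroupLieAlgebra 𝓘(𝕜, E) G)) (range 𝓘(𝕜, E)) : E → E)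
      ((quadraticPart 𝕜 E G).flip X) (chartAt E (1 : G) 1) := by
    intro X
    have h1 : HasFDerivAt (fun x : E => partialSnd 𝕜 (chartMul E G) (x, 0))
        (quadraticPart 𝕜 E G) (chartAt E (1 : G) 1 - chartAt E (1 : G) 1) := by
      rw [sub_self]
      exact hasFDerivAt_partialSnd_chartMul
    have h2 := (hasFDerivAt_comp_sub (f := fun x : E => partialSnd 𝕜 (chartMul E G) (x, 0))
      (chartAt E (1 : G) 1)).2 h1
    have h3 := h2.clm_apply (hasFDerivAt_const X (chartAt E (1 : G) 1))
    refine (h3.congr_of_eventuallyEq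
      (eventually_mpullbackWithin_mulInvariantVectorField X)).congr_fderiv ?_
    ext v
    simp
  have hV0 : ∀ X : E, (VectorField.mpullbackWithin 𝓘(𝕜, E) 𝓘(𝕜, E)
      (extChartAt 𝓘(𝕜, E) (1 : G)).symm
      (mulInvariantVectorField (X : GroupLieAlgebra 𝓘(𝕜, E) G)) (range 𝓘(𝕜, E))
      (chartAt E (1 : G) 1) : E) = X := by
    intro X
    have h1 := (eventually_mpullbackWithin_mulInvariantVectorField (𝕜 := 𝕜) (G := G)
      X).self_of_nhds
    have h2 := (eventually_partialSnd_eq_id ((contDiffAt_chartMul 𝕜 (E := E) (G := G)).of_le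
      ENat.LEInfty.out) eventually_chartMul_zero_left).self_of_nhds
    rw [sub_self, h2] at h1
    exact h1
  rw [GroupLieAlgebra.bracket_def, VectorField.mlieBracket, VectorField.mlieBracketWithin_apply,
    mfderiv_extChartAt_self]
  have hset : (extChartAt 𝓘(𝕜, E) (1 : G)).symm ⁻¹' univ ∩ range 𝓘(𝕜, E) = univ := by simp
  rw [hset]
  have hid : (ContinuousLinearMap.id 𝕜 (TangentSpace 𝓘(𝕜, E) (1 : G))).inverse =
    ContinuousLinearMap.id 𝕜 (TangentSpace 𝓘(𝕜, E) (1 : G)) := ContinuousLinearMap.inverse_id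
  refine (DFunLike.congr_fun hid _).trans ?_
  have key : ∀ {V W : E → E} {V' W' : E →L[𝕜] E} {c v w : E}, HasFDerivAt V V' c →
      HasFDerivAt W W' c → V c = v → W c = w →
      VectorField.lieBracketWithin 𝕜 V W univ c = W' v - V' w := by
    intro V W V' W' c v w h1 h2 h3 h4
    rw [VectorField.lieBracketWithin_univ, VectorField.lieBracket, h1.fderiv, h2.fderiv, h3, h4]
  have h := key (hV X) (hV Y) (hV0 X) (hV0 Y)
  exact h

end Bracket

/-! ### The Lie algebra of a closed subgroup -/

section LieAlgebraOfSubgroup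

variable {𝕜 : Type*} [RCLike 𝕜] {E : Type*} [NormedAddCommGroup E] [NormedSpace 𝕜 E]
  [NormedSpace ℝ E] [IsScalarTower ℝ 𝕜 E]
  {G : Type*} [Group G] [TopologicalSpace G] [ChartedSpace E G]

omit [Group G] [TopologicalSpace G] [ChartedSpace E G] in
theorem HasFDerivAt.tendsto_inv_smul_sub {f : E → E} {f' : E →L[𝕜] E} {x : E}
    (hf : HasFDerivAt f f' x) {d : ℝ → E} {v : E} {l : Filter ℝ} (hd : Tendsto d l (𝓝 0))
    (hv : Tendsto (fun t : ℝ => t⁻¹ • d t) l (𝓝 v)) :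
    Tendsto (fun t : ℝ => t⁻¹ • (f (x + d t) - f x)) l (𝓝 (f' v)) := by
  simp only [RCLike.real_smul_eq_coe_smul (K := 𝕜)] at hv ⊢
  exact hf.hasFDerivWithinAt.lim (s := univ) hd (Eventually.of_forall fun _ => mem_univ _) hv

theorem isOneParameterSubgroup_iff {X : GroupLieAlgebra 𝓘(𝕜, E) G} {γ : ℝ → G} :
    IsOneParameterSubgroup X γ ↔ IsChartOneParameter (unitChart E G) (X : E) γ := by
  have h : (fun t : ℝ => ((t⁻¹ : ℝ) : 𝕜) • (chartAt E (1 : G) (γ t) - chartAt E (1 : G) (1 : G))) =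
      fun t : ℝ => t⁻¹ • unitChart E G (γ t) := by
    funext t
    rw [unitChart_apply, RCLike.real_smul_eq_coe_smul (K := 𝕜)]
  exact ⟨fun ⟨h1, h2, h3⟩ => ⟨h1, h2, h ▸ h3⟩, fun ⟨h1, h2, h3⟩ => ⟨h1, h2, h.symm ▸ h3⟩⟩

theorem lieAlgebraCarrier_eq (S : Subgroup G) :
    lieAlgebraCarrier 𝕜 S = (chartTangent (unitChart E G) S : Set E) := by
  ext X
  exact exists_congr fun γ => and_congr_left' isOneParameterSubgroup_iff

variable [LieGroup 𝓘(𝕜, E) ∞ G] [T2Space G] [FiniteDimensional 𝕜 E] [FiniteDimensional ℝ E]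

/-- The tangent space of an embedded Lie subgroup over `𝕜` is stable under scalars of `𝕜`: read in
a chart that straightens the subgroup to a linear subspace, it is contained in this subspace, and
every vector of the subspace is the velocity of a curve in the subgroup. -/
theorem IsEmbeddedLieSubgroup.smul_mem_chartTangent {S : Subgroup G}
    (hemb : IsEmbeddedLieSubgroup 𝕜 E S) (hS : IsClosed (S : Set G)) (c : 𝕜) {X : E}
    (hX : X ∈ chartTangent (unitChart E G) S) : c • X ∈ chartTangent (unitChart E G) S := by
  have hG : IsTopologicalGroup G := topologicalGroup_of_lieGroup 𝓘(𝕜, E) ∞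
  have : IsManifold 𝓘(𝕜, E) ∞ G := inferInstance
  obtain ⟨C, ρ, hκ⟩ := exists_isGroupChart (E := E) (G := G) 𝕜
  obtain ⟨φ, hφ, h1, V, hV⟩ := hemb 1 S.one_mem
  obtain ⟨γ, hγ, hγS⟩ := hX
  set κ := unitChart E G
  have hκ0 : κ.symm 0 = 1 := unitChart_symm_zero
  have hκ1 : κ 1 = 0 := unitChart_one
  have hφ1 : φ 1 ∈ φ.target := φ.map_source h1
  have hcle : 𝓝[>] (0 : ℝ) ≤ 𝓝[≠] 0 := nhdsWithin_mono _ fun t ht => ne_of_gt ht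
  -- The transition maps between the two charts, and their derivatives.
  have hT : DifferentiableAt 𝕜 (fun u => φ (κ.symm u)) 0 := by
    have e1 : ContMDiffAt 𝓘(𝕜, E) 𝓘(𝕜, E) ∞ φ (κ.symm 0) :=
      hκ0 ▸ contMDiffAt_of_mem_maximalAtlas hφ h1
    exact (e1.comp 0 (contMDiffAt_unitChart_symm
      zero_mem_unitChart_target)).contDiffAt.differentiableAt (by simp)
  have hN : DifferentiableAt 𝕜 (fun v => κ (φ.symm v)) (φ 1) := by
    have e1 : ContMDiffAt 𝓘(𝕜, E) 𝓘(𝕜, E) ∞ κ (φ.symm (φ 1)) := by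
      rw [φ.left_inv h1]
      exact contMDiffAt_unitChart one_mem_unitChart_source
    exact (e1.comp (φ 1) (contMDiffAt_symm_of_mem_maximalAtlas hφ
      hφ1)).contDiffAt.differentiableAt (by simp)
  obtain ⟨T, hT⟩ := hT
  obtain ⟨N, hN⟩ := hN
  have hNT : ∀ v, N (T v) = v := by
    have hN' : HasFDerivAt (fun v => κ (φ.symm v)) N (φ (κ.symm 0)) := by rwa [hκ0]
    have e1 := hN'.comp (0 : E) hT
    have e2 : HasFDerivAt (fun u : E => κ (φ.symm (φ (κ.symm u)))) (ContinuousLinearMap.id 𝕜 E)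
        0 := by
      refine (hasFDerivAt_id (0 : E)).congr_of_eventuallyEq ?_
      have hc : ContinuousAt κ.symm 0 := κ.continuousAt_symm zero_mem_unitChart_target
      filter_upwards [κ.open_target.mem_nhds zero_mem_unitChart_target,
        hc.preimage_mem_nhds (φ.open_source.mem_nhds (by rwa [hκ0]))] with u hu hu'
      rw [φ.left_inv hu', κ.right_inv hu, id]
    intro v
    have := DFunLike.congr_fun (e1.unique e2) v
    simpa using this
  have hTX : T X ∈ V := by
    have hd : Tendsto (fun t => κ (γ t)) (𝓝[>] (0 : ℝ)) (𝓝 0) :=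
      hκ.tendsto_zero (hγ.tendsto_one.mono_left nhdsWithin_le_nhds)
    have hlim := hT.tendsto_inv_smul_sub hd (hγ.tendsto_velocity.mono_left hcle)
    have hcl : IsClosed (V : Set E) := V.closed_of_finiteDimensional
    refine hcl.mem_of_tendsto hlim ?_
    have hγ1 := hγ.tendsto_one.mono_left (nhdsWithin_le_nhds (s := Ioi 0))
    filter_upwards [hγ1.eventually_mem (κ.open_source.mem_nhds hκ.one_mem),
      hγ1.eventually_mem (φ.open_source.mem_nhds h1)] with t ht ht'
    rw [zero_add, κ.left_inv ht, hκ0, RCLike.real_smul_eq_coe_smul (K := 𝕜)]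
    exact V.smul_mem _ (V.sub_mem ((hV _ ht').1 (hγS t)) ((hV _ h1).1 S.one_mem))
  have hid : Tendsto (fun t : ℝ => t) (𝓝[>] 0) (𝓝 0) := nhdsWithin_le_nhds
  have hd : Tendsto (fun t : ℝ => t • (c • T X)) (𝓝[>] (0 : ℝ)) (𝓝 0) := by
    simpa using hid.smul_const (c • T X)
  have hv : Tendsto (fun t : ℝ => t⁻¹ • (t • (c • T X))) (𝓝[>] (0 : ℝ)) (𝓝 (c • T X)) := by
    refine tendsto_const_nhds.congr' ?_
    filter_upwards [self_mem_nhdsWithin] with t ht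
    rw [smul_smul, inv_mul_cancel₀ (ne_of_gt ht), one_smul]
  have hlim := hN.tendsto_inv_smul_sub hd hv
  rw [map_smul, hNT, φ.left_inv h1, hκ1] at hlim
  simp only [sub_zero] at hlim
  have hadd : Tendsto (fun t : ℝ => φ 1 + t • (c • T X)) (𝓝[>] (0 : ℝ)) (𝓝 (φ 1)) := by
    simpa using tendsto_const_nhds.add hd
  have h2 := (φ.continuousAt_symm hφ1).tendsto.comp hadd
  rw [φ.left_inv h1] at h2
  refine hκ.exists_oneParameter_of_tendsto hS (t := fun t : ℝ => t) tendsto_id h2 ?_ hlim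
  filter_upwards [hadd.eventually_mem (φ.open_target.mem_nhds hφ1)] with t ht
  refine (hV _ (φ.map_target ht)).2 ?_
  rw [φ.right_inv ht, RCLike.real_smul_eq_coe_smul (K := 𝕜)]
  exact V.add_mem ((hV _ h1).1 S.one_mem) (V.smul_mem _ (V.smul_mem _ hTX))

/-- When `I = 0`, scalars of `𝕜` are real and no embeddedness is needed. -/
theorem smul_mem_chartTangent_of_isEmbedded {S : Subgroup G} (hS : IsClosed (S : Set G))
    (hemb : (RCLike.I : 𝕜) ≠ 0 → IsEmbeddedLieSubgroup 𝕜 E S) (c : 𝕜) {X : E}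
    (hX : X ∈ chartTangent (unitChart E G) S) : c • X ∈ chartTangent (unitChart E G) S := by
  by_cases hI : (RCLike.I : 𝕜) = 0
  · obtain ⟨C, ρ, hκ⟩ := exists_isGroupChart (E := E) (G := G) 𝕜
    have hc : c = (RCLike.re c : 𝕜) := by
      conv_lhs => rw [← RCLike.re_add_im c, hI, mul_zero, add_zero]
    rw [hc, ← RCLike.real_smul_eq_coe_smul]
    exact smul_mem_chartTangent hκ _ hX
  · exact (hemb hI).smul_mem_chartTangent hS c hX

/-- A closed subgroup of a Lie group (over `ℂ`, one that is a complex submanifold) has a Lie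
algebra. -/
theorem exists_isLieAlgebraOf [CompleteSpace E] {S : Subgroup G} (hS : IsClosed (S : Set G))
    (hemb : (RCLike.I : 𝕜) ≠ 0 → IsEmbeddedLieSubgroup 𝕜 E S) :
    ∃ 𝔥 : LieSubalgebra 𝕜 (GroupLieAlgebra 𝓘(𝕜, E) G), IsLieAlgebraOf 𝔥 S := by
  have hG : IsTopologicalGroup G := topologicalGroup_of_lieGroup 𝓘(𝕜, E) ∞
  obtain ⟨C, ρ, hκ⟩ := exists_isGroupChart (E := E) (G := G) 𝕜
  let V : Submodule 𝕜 (GroupLieAlgebra 𝓘(𝕜, E) G) :=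
    { carrier := lieAlgebraCarrier 𝕜 S
      zero_mem' := by
        rw [lieAlgebraCarrier_eq]
        exact (chartTangentSubmodule hκ hS).zero_mem
      add_mem' := by
        rw [lieAlgebraCarrier_eq]
        exact add_mem_chartTangent hκ hS
      smul_mem' := by
        rw [lieAlgebraCarrier_eq]
        exact fun c X hX => smul_mem_chartTangent_of_isEmbedded hS hemb c hX }
  refine ⟨{ V with lie_mem' := ?_ }, rfl⟩
  intro X Y hX hY
  change ⁅X, Y⁆ ∈ lieAlgebraCarrier 𝕜 S
  replace hX : X ∈ lieAlgebraCarrier 𝕜 S := hX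
  replace hY : Y ∈ lieAlgebraCarrier 𝕜 S := hY
  rw [lieAlgebraCarrier_eq] at hX hY ⊢
  rw [bracket_eq_quadraticPart]
  exact bracket_mem_chartTangent hκ hS
    (L := (quadraticPart 𝕜 E G).bilinearRestrictScalars ℝ)
    (fun ε hε => norm_unitChart_mul_sub_le ε hε) hX hY

end LieAlgebraOfSubgroup

/-! ### Null sets for the Haar measure -/

section Covering

variable {G : Type*} [Group G] [TopologicalSpace G] [IsTopologicalGroup G]
  [SecondCountableTopology G]

theorem exists_countable_left_translates (S : Subgroup G) {U : Set G} (hU : U ∈ 𝓝 (1 : G)) :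
    ∃ T ⊆ (S : Set G), T.Countable ∧ ∀ x ∈ S, ∃ g ∈ T, g⁻¹ * x ∈ U := by
  obtain ⟨T, hTS, hT, hcov⟩ := TopologicalSpace.countable_cover_nhdsWithin
    (f := fun g : G => (fun x => g⁻¹ * x) ⁻¹' U) (s := (S : Set G)) fun g _ =>
      mem_nhdsWithin_of_mem_nhds
        ((continuous_const_mul g⁻¹).continuousAt.preimage_mem_nhds (by simpa using hU))
  exact ⟨T, hTS, hT, fun x hx => by simpa using hcov hx⟩

theorem exists_countable_right_translates (S : Subgroup G) {U : Set G} (hU : U ∈ 𝓝 (1 : G)) :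
    ∃ T ⊆ (S : Set G), T.Countable ∧ ∀ x ∈ S, ∃ g ∈ T, x * g⁻¹ ∈ U := by
  obtain ⟨T, hTS, hT, hcov⟩ := TopologicalSpace.countable_cover_nhdsWithin
    (f := fun g : G => (fun x => x * g⁻¹) ⁻¹' U) (s := (S : Set G)) fun g _ =>
      mem_nhdsWithin_of_mem_nhds
        ((continuous_mul_const g⁻¹).continuousAt.preimage_mem_nhds (by simpa using hU))
  exact ⟨T, hTS, hT, fun x hx => by simpa using hcov hx⟩

end Covering

/-- A measurable set is null for the Haar measure as soon as all its right translates are null for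
Lebesgue measure in some chart. This is Tonelli's theorem for the indicator of `x y ∈ K`,
integrated in `x` against Lebesgue measure and in `y` against Haar measure. -/
theorem haar_eq_zero_of_forall_chart_image {G : Type*} [Group G] [TopologicalSpace G]
    [IsTopologicalGroup G] [SecondCountableTopology G] [LocallyCompactSpace G]
    [MeasurableSpace G] [BorelSpace G] (μ : Measure G) [μ.IsHaarMeasure]
    {E : Type*} [NormedAddCommGroup E] [MeasurableSpace E] [BorelSpace E]
    (ν : Measure E) [SFinite ν] [ν.IsOpenPosMeasure]
    (κ : OpenPartialHomeomorph G E) (hne : κ.source.Nonempty) {K : Set G} (hK : MeasurableSet K)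
    (h : ∀ y : G, ν (κ '' {x ∈ κ.source | x * y ∈ K}) = 0) : μ K = 0 := by
  have hmeas : AEMeasurable κ.symm (ν.restrict κ.target) :=
    κ.continuousOn_symm.aemeasurable κ.open_target.measurableSet
  set ν' : Measure G := (ν.restrict κ.target).map κ.symm
  have hnull : ∀ y : G, ν' {x | x * y ∈ K} = 0 := by
    intro y
    have hm : MeasurableSet {x | x * y ∈ K} := measurable_mul_const y hK
    have hi : κ '' {x ∈ κ.source | x * y ∈ K} = κ.symm ⁻¹' {x | x * y ∈ K} ∩ κ.target := by
      rw [inter_comm, ← κ.image_source_inter_eq']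
      rfl
    rw [Measure.map_apply_of_aemeasurable hmeas hm,
      Measure.restrict_apply' κ.open_target.measurableSet, ← hi, h y]
  have huniv : ν' univ ≠ 0 := by
    rw [Measure.map_apply_of_aemeasurable hmeas MeasurableSet.univ, preimage_univ,
      Measure.restrict_apply_univ]
    obtain ⟨x, hx⟩ := hne
    exact (κ.open_target.measure_pos ν ⟨κ x, κ.map_source hx⟩).ne'
  have hswap := lintegral_lintegral_swap (μ := ν') (ν := μ)
    (f := fun x y => K.indicator (fun _ => (1 : ENNReal)) (x * y))
    ((measurable_const.indicator hK).comp measurable_mul).aemeasurable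
  have hL : ∀ x, ∫⁻ y, K.indicator (fun _ => (1 : ENNReal)) (x * y) ∂μ = μ K := by
    intro x
    rw [lintegral_mul_left_eq_self (fun y => K.indicator (fun _ => (1 : ENNReal)) y) x,
      lintegral_indicator_const hK, one_mul]
  have hR : ∀ y, ∫⁻ x, K.indicator (fun _ => (1 : ENNReal)) (x * y) ∂ν' = 0 := by
    intro y
    have := lintegral_indicator_const (μ := ν') (measurable_mul_const y hK) (1 : ENNReal)
    rw [one_mul] at this
    exact this.trans (hnull y)
  simp only [hL, hR, lintegral_const, zero_mul] at hswap
  exact (mul_eq_zero.1 hswap).resolve_right huniv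

/-- A set with a map to `F` that does not contract distances by more than a constant factor has
Hausdorff dimension at most `dim F`. -/
theorem dimH_le_finrank_of_antilipschitz {E F : Type*} [NormedAddCommGroup E]
    [NormedAddCommGroup F] [NormedSpace ℝ F] [FiniteDimensional ℝ F] {s : Set E} {Q : E → F}
    {K : ℝ} (hK : 0 ≤ K) (h : ∀ x ∈ s, ∀ y ∈ s, ‖x - y‖ ≤ K * ‖Q x - Q y‖) :
    dimH s ≤ Module.finrank ℝ F := by
  have hanti : AntilipschitzWith K.toNNReal fun x : s => Q x :=
    AntilipschitzWith.of_le_mul_dist fun x y => by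
      rw [Subtype.dist_eq, dist_eq_norm, dist_eq_norm, Real.coe_toNNReal K hK]
      exact h x x.2 y y.2
  have h1 : dimH (univ : Set s) = dimH s := by
    rw [← isometry_subtype_coe.dimH_image, image_univ, Subtype.range_coe]
  rw [← h1]
  exact (hanti.le_dimH_image univ).trans
    ((dimH_mono (subset_univ _)).trans_eq (Real.dimH_univ_eq_finrank F))

section MatchedPair

variable {𝕜 : Type*} [RCLike 𝕜] {E : Type*} [NormedAddCommGroup E] [NormedSpace 𝕜 E]
  [NormedSpace ℝ E] [IsScalarTower ℝ 𝕜 E] [FiniteDimensional ℝ E]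
  {G : Type*} [Group G] [TopologicalSpace G] [ChartedSpace E G]

/-- Translates of `K₁ K₂` have, in the chart, at most the Hausdorff dimension of `K₁ × K₂`, as they
are images of parts of it under a smooth map. -/
theorem dimH_chart_image_le [IsTopologicalGroup G] [LieGroup 𝓘(𝕜, E) ∞ G] {K₁ K₂ : Set G}
    (h1 : K₁ ⊆ (unitChart E G).source) (h2 : K₂ ⊆ (unitChart E G).source) (k y : G) :
    dimH (unitChart E G '' {x ∈ (unitChart E G).source | x * y ∈
      (fun p : G × G => p.1 * p.2 * k) '' (K₁ ×ˢ K₂)}) ≤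
      dimH ((unitChart E G '' K₁) ×ˢ (unitChart E G '' K₂)) := by
  set κ := unitChart E G
  set A : Set (E × E) := {p ∈ (κ '' K₁) ×ˢ (κ '' K₂) |
    κ.symm p.1 * κ.symm p.2 * (k * y⁻¹) ∈ κ.source}
  have hsub : κ '' {x ∈ κ.source | x * y ∈ (fun p : G × G => p.1 * p.2 * k) '' (K₁ ×ˢ K₂)} ⊆
      (fun p : E × E => κ (κ.symm p.1 * κ.symm p.2 * (k * y⁻¹))) '' A := by
    rintro _ ⟨x, ⟨hx, ⟨a, b⟩, ⟨ha, hb⟩, hab⟩, rfl⟩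
    have e : κ.symm (κ a) * κ.symm (κ b) * (k * y⁻¹) = x := by
      rw [κ.left_inv (h1 ha), κ.left_inv (h2 hb), ← mul_assoc, mul_inv_eq_iff_eq_mul]
      exact hab
    exact ⟨(κ a, κ b), ⟨⟨⟨a, ha, rfl⟩, ⟨b, hb, rfl⟩⟩, e ▸ hx⟩, congrArg κ e⟩
  refine (dimH_mono hsub).trans ((dimH_image_le_of_locally_lipschitzOn fun p hp => ?_).trans
    (dimH_mono (sep_subset _ _)))
  obtain ⟨⟨⟨a, ha, hpa⟩, ⟨b, hb, hpb⟩⟩, hp⟩ := hp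
  have hd : ContDiffAt 𝕜 ∞ (fun p : E × E => κ (κ.symm p.1 * κ.symm p.2 * (k * y⁻¹))) p :=
    contDiffAt_unitChart_mul_mul (hpa ▸ κ.map_source (h1 ha)) (hpb ▸ κ.map_source (h2 hb)) _ hp
  obtain ⟨C, t, ht, hC⟩ := ((hd.restrict_scalars ℝ).of_le
    (ENat.LEInfty.out : (1 : WithTop ℕ∞) ≤ ∞)).exists_lipschitzOnWith
  exact ⟨C, t, mem_nhdsWithin_of_mem_nhds ht, hC⟩

/-- If the dimensions of the Lie algebras of two closed subgroups add up to less than the dimension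
of `G`, the product of the subgroups is a null set. -/
theorem haar_mul_eq_zero_of_finrank_lt [IsTopologicalGroup G] [LieGroup 𝓘(𝕜, E) ∞ G] [T2Space G]
    [SecondCountableTopology G] [MeasurableSpace G] [BorelSpace G]
    (μ : Measure G) [μ.IsHaarMeasure] {C ρ : ℝ} (hκ : IsGroupChart (unitChart E G) C ρ)
    {S₁ S₂ : Subgroup G} (hS₁ : IsClosed (S₁ : Set G)) (hS₂ : IsClosed (S₂ : Set G))
    (hlt : Module.finrank ℝ (chartTangentSubmodule hκ hS₁) +
      Module.finrank ℝ (chartTangentSubmodule hκ hS₂) < Module.finrank ℝ E) :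
    μ {x | ∃ a ∈ S₁, ∃ b ∈ S₂, a * b = x} = 0 := by
  have : ProperSpace E := FiniteDimensional.proper ℝ E
  have : LocallyCompactSpace G := ChartedSpace.locallyCompactSpace E G
  have hρ := hκ.radius_pos
  obtain ⟨P₁, hP₁⟩ := Submodule.ClosedComplemented.of_finiteDimensional
    (chartTangentSubmodule hκ hS₁)
  obtain ⟨P₂, hP₂⟩ := Submodule.ClosedComplemented.of_finiteDimensional
    (chartTangentSubmodule hκ hS₂)
  obtain ⟨C₁, hC₁, r₁, hr₁, hr₁ρ, hb₁⟩ := exists_antilipschitz_on_chartBall hκ hS₁ P₁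
    fun X hX h0 => by simpa [h0] using (congrArg Subtype.val (hP₁ ⟨X, hX⟩)).symm
  obtain ⟨C₂, hC₂, r₂, hr₂, hr₂ρ, hb₂⟩ := exists_antilipschitz_on_chartBall hκ hS₂ P₂
    fun X hX h0 => by simpa [h0] using (congrArg Subtype.val (hP₂ ⟨X, hX⟩)).symm
  set κ := unitChart E G
  set K₁ := (S₁ : Set G) ∩ chartBall κ r₁
  set K₂ := (S₂ : Set G) ∩ chartBall κ r₂
  have hK₁ : IsCompact K₁ := (hκ.isCompact_chartBall hr₁ρ).inter_left hS₁
  have hK₂ : IsCompact K₂ := (hκ.isCompact_chartBall hr₂ρ).inter_left hS₂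
  have hdim : dimH ((κ '' K₁) ×ˢ (κ '' K₂)) < Module.finrank ℝ E := by
    refine lt_of_le_of_lt (dimH_le_finrank_of_antilipschitz (K := max C₁ C₂)
      (Q := fun p : E × E => (P₁ p.1, P₂ p.2)) (by positivity) ?_)
      (by rw [Module.finrank_prod]; exact_mod_cast hlt)
    rintro ⟨_, _⟩ ⟨⟨a, ha, rfl⟩, ⟨b, hb, rfl⟩⟩ ⟨_, _⟩ ⟨⟨a', ha', rfl⟩, ⟨b', hb', rfl⟩⟩
    have e1 := hb₁ a ha.2 a' ha'.2 ha.1 ha'.1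
    have e2 := hb₂ b hb.2 b' hb'.2 hb.1 hb'.1
    simp only [Prod.mk_sub_mk, Prod.norm_mk]
    refine max_le (e1.trans ?_) (e2.trans ?_)
    · gcongr
      exacts [le_max_left _ _, le_max_left _ _]
    · gcongr
      exacts [le_max_right _ _, le_max_right _ _]
  have hs₁ : K₁ ⊆ κ.source := fun x hx => hx.2.1
  have hs₂ : K₂ ⊆ κ.source := fun x hx => hx.2.1
  have hnull : ∀ k : G, μ ((fun p : G × G => p.1 * p.2 * k) '' (K₁ ×ˢ K₂)) = 0 := by
    intro k
    borelize E
    refine haar_eq_zero_of_forall_chart_image μ (Measure.hausdorffMeasure (Module.finrank ℝ E))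
      κ ⟨1, hκ.one_mem⟩ ?_ fun y => ?_
    · exact ((hK₁.prod hK₂).image (by fun_prop)).isClosed.measurableSet
    · have := hausdorffMeasure_of_dimH_lt (d := Module.finrank ℝ E)
        (lt_of_le_of_lt (dimH_chart_image_le (𝕜 := 𝕜) hs₁ hs₂ k y)
          (by simpa using hdim))
      simpa using this
  obtain ⟨T₁, hT₁S, hT₁, hcov₁⟩ := exists_countable_left_translates S₁ (hκ.chartBall_mem_nhds hr₁)
  obtain ⟨T₂, hT₂S, hT₂, hcov₂⟩ := exists_countable_right_translates S₂ (hκ.chartBall_mem_nhds hr₂)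
  have hsub : {x | ∃ a ∈ S₁, ∃ b ∈ S₂, a * b = x} ⊆ ⋃ g ∈ T₁, ⋃ k ∈ T₂,
      (fun x => g⁻¹ * x) ⁻¹' ((fun p : G × G => p.1 * p.2 * k) '' (K₁ ×ˢ K₂)) := by
    rintro _ ⟨a, ha, b, hb, rfl⟩
    obtain ⟨g, hg, hga⟩ := hcov₁ a ha
    obtain ⟨k, hk, hkb⟩ := hcov₂ b hb
    refine mem_iUnion₂.2 ⟨g, hg, mem_iUnion₂.2 ⟨k, hk, ⟨(g⁻¹ * a, b * k⁻¹), ⟨⟨?_, hga⟩, ?_, hkb⟩,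
      by simp [mul_assoc]⟩⟩⟩
    · exact S₁.mul_mem (S₁.inv_mem (hT₁S hg)) ha
    · exact S₂.mul_mem hb (S₂.inv_mem (hT₂S hk))
  refine measure_mono_null hsub ((measure_biUnion_null_iff hT₁).2 fun g _ =>
    (measure_biUnion_null_iff hT₂).2 fun k _ => ?_)
  rw [measure_preimage_mul]
  exact hnull k

omit [FiniteDimensional ℝ E] [ChartedSpace E G] in
/-- The tangent spaces of two closed subgroups with trivial intersection meet in `0`, since a
common velocity belongs to a one-parameter subgroup that is trivial near `0`. -/
theorem eq_zero_of_mem_chartTangent {κ : OpenPartialHomeomorph G E} {C ρ : ℝ}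
    (hκ : IsGroupChart κ C ρ) {S₁ S₂ : Subgroup G} (hinter : (S₁ : Set G) ∩ S₂ = {1}) {X : E}
    (h1 : X ∈ chartTangent κ S₁) (h2 : X ∈ chartTangent κ S₂) : X = 0 := by
  obtain ⟨γ, hγ, hγS⟩ := h1
  obtain ⟨η, hη, hηS⟩ := h2
  refine tendsto_nhds_unique hγ.tendsto_velocity (tendsto_const_nhds.congr' ?_)
  filter_upwards [nhdsWithin_le_nhds (hγ.eventually_eq hκ hη)] with t ht
  have : γ t ∈ (S₁ : Set G) ∩ S₂ := ⟨hγS t, ht ▸ hηS t⟩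
  rw [hinter] at this
  rw [this, hκ.map_one, smul_zero]

/-- If two closed subgroups meet trivially and their product has null complement, the Lie algebra of
`G` is the direct sum of their tangent spaces: otherwise the dimensions are too small and the product
itself is null, hence so is `G`. -/
theorem isCompl_chartTangentSubmodule [IsTopologicalGroup G] [LieGroup 𝓘(𝕜, E) ∞ G] [T2Space G]
    [SecondCountableTopology G] [MeasurableSpace G] [BorelSpace G]
    (μ : Measure G) [μ.IsHaarMeasure] {C ρ : ℝ} (hκ : IsGroupChart (unitChart E G) C ρ)
    {S₁ S₂ : Subgroup G} (hS₁ : IsClosed (S₁ : Set G)) (hS₂ : IsClosed (S₂ : Set G))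
    (hinter : (S₁ : Set G) ∩ S₂ = {1}) (hnull : μ {x | ∃ a ∈ S₁, ∃ b ∈ S₂, a * b = x}ᶜ = 0) :
    IsCompl (chartTangentSubmodule hκ hS₁) (chartTangentSubmodule hκ hS₂) := by
  have hdisj : Disjoint (chartTangentSubmodule hκ hS₁) (chartTangentSubmodule hκ hS₂) :=
    Submodule.disjoint_def.2 fun X h1 h2 => eq_zero_of_mem_chartTangent hκ hinter h1 h2
  refine ⟨hdisj, codisjoint_iff.2 (Submodule.eq_top_of_finrank_eq ?_)⟩
  by_contra hne
  have hsum := Submodule.finrank_sup_add_finrank_inf_eq (chartTangentSubmodule hκ hS₁)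
    (chartTangentSubmodule hκ hS₂)
  rw [hdisj.eq_bot, finrank_bot, add_zero] at hsum
  have hlt := haar_mul_eq_zero_of_finrank_lt (𝕜 := 𝕜) μ hκ hS₁ hS₂
    (hsum ▸ lt_of_le_of_ne (Submodule.finrank_le _) hne)
  have huniv : μ univ = 0 := by
    rw [← union_compl_self {x | ∃ a ∈ S₁, ∃ b ∈ S₂, a * b = x}]
    exact measure_union_null hlt hnull
  exact isOpen_univ.measure_ne_zero μ univ_nonempty huniv

end MatchedPair

end

theorem mainTheorem3 {𝕜 : Type*} [RCLike 𝕜]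
    {E : Type*} [NormedAddCommGroup E] [NormedSpace 𝕜 E] [FiniteDimensional 𝕜 E]
    [CompleteSpace E]
    {G : Type*} [Group G] [TopologicalSpace G] [T2Space G] [SecondCountableTopology G]
    [ChartedSpace E G] [LieGroup 𝓘(𝕜, E) ∞ G]
    {G₁ : Type*} [Group G₁] [TopologicalSpace G₁] [IsTopologicalGroup G₁] [LocallyCompactSpace G₁]
    {G₂ : Type*} [Group G₂] [TopologicalSpace G₂] [IsTopologicalGroup G₂] [LocallyCompactSpace G₂]
    [MeasurableSpace G] [BorelSpace G] (μ : MeasureTheory.Measure G) [μ.IsHaarMeasure]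
    (i : G₁ →* G) (j : G₂ᵐᵒᵖ →* G) (hij : IsMatchedPairOfGroups μ i j)
    -- In the complex case only, the two closed subgroups are complex Lie subgroups.
    (hi : (RCLike.I : 𝕜) ≠ 0 → IsEmbeddedLieSubgroup 𝕜 E i.range)
    (hj : (RCLike.I : 𝕜) ≠ 0 → IsEmbeddedLieSubgroup 𝕜 E j.range) :
    ∃ 𝔤₁ 𝔤₂ : LieSubalgebra 𝕜 (GroupLieAlgebra 𝓘(𝕜, E) G),
      IsLieAlgebraOf 𝔤₁ i.range ∧ IsLieAlgebraOf 𝔤₂ j.range ∧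
        IsMatchedPairOfLieAlgebras 𝔤₁ 𝔤₂ := by

  let _ : NormedSpace ℝ E := NormedSpace.restrictScalars ℝ 𝕜 E
  have : IsScalarTower ℝ 𝕜 E := RestrictScalars.isScalarTower ℝ 𝕜 E
  have : FiniteDimensional ℝ E := FiniteDimensional.trans ℝ 𝕜 E
  have hG : IsTopologicalGroup G := topologicalGroup_of_lieGroup 𝓘(𝕜, E) ∞
  have hcl₁ : IsClosed (i.range : Set G) := by
    simpa using hij.isClosedEmbedding_left.isClosed_range
  have hrange : Set.range (fun s : G₂ => j (MulOpposite.op s)) = Set.range j :=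
    MulOpposite.opEquiv.surjective.range_comp j
  have hcl₂ : IsClosed (j.range : Set G) := by
    simpa [hrange] using hij.isClosedEmbedding_right.isClosed_range
  obtain ⟨C, ρ, hκ⟩ := exists_isGroupChart (E := E) (G := G) 𝕜
  obtain ⟨𝔤₁, h₁⟩ := exists_isLieAlgebraOf hcl₁ hi
  obtain ⟨𝔤₂, h₂⟩ := exists_isLieAlgebraOf hcl₂ hj
  have hprod : {x : G | ∃ (g : G₁) (s : G₂), i g * j (MulOpposite.op s) = x} =
      {x | ∃ a ∈ i.range, ∃ b ∈ j.range, a * b = x} := by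
    ext x
    constructor
    · rintro ⟨g, s, h⟩
      exact ⟨i g, ⟨g, rfl⟩, _, ⟨_, rfl⟩, h⟩
    · rintro ⟨_, ⟨g, rfl⟩, _, ⟨s, rfl⟩, h⟩
      exact ⟨g, s.unop, h⟩
  have hcompl := isCompl_chartTangentSubmodule (𝕜 := 𝕜) μ hκ hcl₁ hcl₂
    (by simpa using hij.inter_eq) (hprod ▸ hij.measure_compl_eq_zero)
  have e₁ : ∀ X : GroupLieAlgebra 𝓘(𝕜, E) G,
      X ∈ 𝔤₁ ↔ (X : E) ∈ chartTangentSubmodule hκ hcl₁ := fun X => by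
    rw [← SetLike.mem_coe, h₁, lieAlgebraCarrier_eq]
    rfl
  have e₂ : ∀ X : GroupLieAlgebra 𝓘(𝕜, E) G,
      X ∈ 𝔤₂ ↔ (X : E) ∈ chartTangentSubmodule hκ hcl₂ := fun X => by
    rw [← SetLike.mem_coe, h₂, lieAlgebraCarrier_eq]
    rfl
  have hzero : ∀ X : E, X ∈ chartTangentSubmodule hκ hcl₁ → X ∈ chartTangentSubmodule hκ hcl₂ →
      X = 0 := Submodule.disjoint_def.1 hcompl.disjoint
  have hsum : ∀ X : E, ∃ Y ∈ chartTangentSubmodule hκ hcl₁, ∃ Z ∈ chartTangentSubmodule hκ hcl₂,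
      Y + Z = X := fun X =>
    Submodule.mem_sup.1 (hcompl.sup_eq_top ▸ Submodule.mem_top)
  refine ⟨𝔤₁, 𝔤₂, h₁, h₂, Submodule.disjoint_def.2 fun X hX hX' => ?_,
    codisjoint_iff.2 (eq_top_iff.2 fun X _ => ?_)⟩
  · exact hzero X ((e₁ X).1 hX) ((e₂ X).1 hX')
  · obtain ⟨Y, hY, Z, hZ, hYZ⟩ := hsum X
    exact Submodule.mem_sup.2 ⟨Y, (e₁ Y).2 hY, Z, (e₂ Z).2 hZ, hYZ⟩
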